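/- Let $(E\cup\{\partial\},\rho)$ be a compact metric space with its Borel $\sigma$-field, where $\partial\notin E$ and $E\neq\emptyset$. Let $X=(X_t)_{t\ge 0}$ be a process with values in $E\cup\{\partial\}$ and continuous paths, which under the laws $(\mathbb P_x)_{x\in E\cup\{\partial\}}$ (with $\mathbb P_x(X_0=x)=1$) is strong Markov with respect to its natural filtration, and which is absorbed at $\partial$ at time $\tau_\partial=\inf\{t\ge 0: X_t=\partial\}$. Assume $\mathbb P_x(t<\tau_\partial)>0$ for all $x\in E$, $t\ge 0$. For bounded measurable $f:E\cup\{\partial\}\to\mathbb R$ let $P_tf(x)=\mathbb E_x(f(X_t)\mathbf 1_{t<\tau_\partial})$. Write $\rho_\partial(x)=\rho(x,\partial)$, $T_K=\inf\{t\ge 0: X_t\in K\}$, $\mathbb P_\mu=\int\mathbb P_x\,\mu(dx)$, $\mu(\rho_\partial)=\int\rho_\partial\,d\mu$, and let $\|\cdot\|_{TV}$ be the total variation norm on finite signed measures. Assume that for some $t_1>0$: 1. there is a constant $C$ such that, for all bounded measurable $f:E\cup\{\partial\}\to\mathbb R$, $$\|\nabla P_{t_1}f\|_\infty:=\sup_{x,y\in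 E\cup\{\partial\},\,x\ne y}\frac{|P_{t_1}f(x)-P_{t_1}f(y)|}{\rho(x,y)}\le C\|f\|_\infty;$$ 2. there are a compact set $K\subset E$ and a constant $C'>0$ such that $\mathbb P_x(T_K\le t_1<\tau_\partial)\ge C'\rho_\partial(x)$ for all $x\in E$; 3. for all $x,y\in E$ and $r>0$, $\mathbb P_x(X_s\in B(y,r)\ \forall s\in[t_1,2t_1])>0$, where $B(y,r)$ is the ball of radius $r$ centered at $y$. Then: (a) Condition (A) holds: there exist $t_0,c_1,c_2>0$ and a probability measure $\nu$ on $E$ such that (A1) $\mathbb P_x(X_{t_0}\in\cdot\mid t_0<\tau_\partial)\ge c_1\nu(\cdot)$ for all $x\in E$, and (A2) $\mathbb P_\nu(t<\tau_\partial)\ge c_2\mathbb P_z(t<\tau_\partial)$ for all $z\in E$, $t\ge 0$. (b) There is a unique quasi-stationary distribution $\alpha$, that is, a unique probability measure $\alpha$ on $E$ with $\alpha=\mathbb P_\alpha(X_t\in\cdot\mid t<\tau_\partial)$ for all $t\ge 0$; moreover there are constants $B,\gamma>0$ such that, for every probability measure $\mu$ on $E$ and every $t\ge 0$, $$\|\mathbb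 P_\mu(X_t\in\cdot\mid t<\tau_\partial)-\alpha\|_{TV}\le Be^{-\gamma t}.$$ (c) There are constants $B,\gamma>0$ such that, for all probability measures $\mu_1,\mu_2$ on $E$ and all $t\ge 0$, $$\|\mathbb P_{\mu_1}(X_t\in\cdot\mid t<\tau_\partial)-\mathbb P_{\mu_2}(X_t\in\cdot\mid t<\tau_\partial)\|_{TV}\le\frac{Be^{-\gamma t}}{\mu_1(\rho_\partial)\vee\mu_2(\rho_\partial)}\,\|\mu_1-\mu_2\|_{TV}.$$ -/

import Mathlib

open MeasureTheory ProbabilityTheory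
open scoped NNReal ENNReal

noncomputable section

namespace QSD

variable {M Ω : Type*} [MetricSpace M] [MeasurableSpace M] [MeasurableSpace Ω]

/-- The first hitting time `inf {t ≥ 0 | X_t ∈ S}` of a set `S` (equal to `⊤` if `S` is never
hit). -/
def hitTime (X : ℝ≥0 → Ω → M) (S : Set M) : Ω → WithTop ℝ≥0 :=
  hittingAfter X S 0

/-- The event `{t < τ_∂}` of non-absorption up to time `t`. -/
def alive (X : ℝ≥0 → Ω → M) (cem : M) (t : ℝ≥0) : Set Ω :=
  {ω | (t : WithTop ℝ≥0) < hitTime X {cem} ω}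

/-- `X` is a process in the metric space `M = E ∪ {∂}`, with `∂ = cem`, which is continuous,
strong Markov under the family of laws `P x`, `x ∈ M` (with respect to its natural filtration)
and absorbed at `∂`. -/
structure IsAbsorbedStrongMarkov [CompactSpace M] [BorelSpace M] (cem : M)
    (X : ℝ≥0 → Ω → M) (P : Kernel M Ω) : Prop where
  /-- each `X_t` is a random variable -/
  measurable : ∀ t, Measurable (X t)
  /-- all paths are continuous -/
  continuous_paths : ∀ ω, Continuous fun t => X t ω
  /-- under `P_x` the process starts from `x` -/
  initial : ∀ x, ∀ᵐ ω ∂(P x), X 0 ω = x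
  /-- once the process is at `∂`, it stays there -/
  absorbed : ∀ x, ∀ᵐ ω ∂(P x), ∀ s t, s ≤ t → X s ω = cem → X t ω = cem
  /-- strong Markov property: for each stopping time `T`, conditionally on `ℱ_T` and on
  `T < ∞`, the shifted path `(X_{T+s})_{s ≥ 0}` has the law of `X` under `P_{X_T}` -/
  strong_markov : ∀ (T : Ω → WithTop ℝ≥0)
    (hT : IsStoppingTime
      (Filtration.natural X fun t => (measurable t).stronglyMeasurable) T)
    (A : Set Ω), MeasurableSet[hT.measurableSpace] A →
    ∀ D : Set (ℝ≥0 → M), MeasurableSet D → ∀ x,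
      P x (A ∩ {ω | T ω ≠ ⊤} ∩ {ω | (fun s => X ((T ω).untopD 0 + s) ω) ∈ D}) =
        ∫⁻ ω in A ∩ {ω | T ω ≠ ⊤},
          P (X ((T ω).untopD 0) ω) {ω' | (fun s => X s ω') ∈ D} ∂(P x)

/-- The Dirichlet semigroup `P_t f(x) = 𝔼_x (f(X_t) 1_{t < τ_∂})`. -/
def dirichletSemigroup (cem : M) (X : ℝ≥0 → Ω → M) (P : Kernel M Ω) (t : ℝ≥0)
    (f : M → ℝ) (x : M) : ℝ :=
  ∫ ω in alive X cem t, f (X t ω) ∂(P x)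

/-- `‖f‖_∞ = sup_x |f(x)|`, with values in `[0, ∞]`. -/
def supNorm (f : M → ℝ) : ℝ≥0∞ := ⨆ x, ‖f x‖ₑ

/-- `‖∇f‖_∞ = sup_{x, y} |f(x) - f(y)| / ρ(x, y)`, with values in `[0, ∞]`; the diagonal
terms are `0 / 0 = 0`. -/
def gradNorm (f : M → ℝ) : ℝ≥0∞ := ⨆ x, ⨆ y, ‖f x - f y‖ₑ / edist x y

/-- The conditional law `Q(X_t ∈ · | t < τ_∂)`, for a law `Q` on the sample space. The law
with initial distribution `μ` is `Q = P ∘ₘ μ`, i.e. `Q = ∫ P_x μ(dx)`. -/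
def condLaw (cem : M) (X : ℝ≥0 → Ω → M) (Q : Measure Ω) (t : ℝ≥0) : Measure M :=
  (Q[|alive X cem t]).map (X t)

instance (cem : M) (X : ℝ≥0 → Ω → M) (Q : Measure Ω) (t : ℝ≥0) :
    IsFiniteMeasure (condLaw cem X Q t) := by
  unfold condLaw; infer_instance

/-- The total variation norm `‖μ₁ - μ₂‖_TV = |μ₁ - μ₂|(M)`. -/
def tvDist (μ₁ μ₂ : Measure M) [IsFiniteMeasure μ₁] [IsFiniteMeasure μ₂] : ℝ :=
  (μ₁.toSignedMeasure - μ₂.toSignedMeasure).totalVariation.real Set.univ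

/-- Probability measures on `E = M \ {∂}`, as probability measures on `M` without mass at
`∂`. -/
def IsProbOn (cem : M) (μ : Measure M) : Prop :=
  IsProbabilityMeasure μ ∧ μ {cem} = 0

/-- Condition (A): there are `t₀, c₁, c₂ > 0` and a probability measure `ν` on `E` such that
(A1) `ℙ_x(X_{t₀} ∈ · | t₀ < τ_∂) ≥ c₁ ν` for all `x ∈ E`, and
(A2) `ℙ_ν(t < τ_∂) ≥ c₂ ℙ_z(t < τ_∂)` for all `z ∈ E` and `t ≥ 0`. -/
def ConditionA (cem : M) (X : ℝ≥0 → Ω → M) (P : Kernel M Ω) : Prop :=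
  ∃ t₀ c₁ c₂ : ℝ≥0, 0 < t₀ ∧ 0 < c₁ ∧ 0 < c₂ ∧ ∃ ν : Measure M, IsProbOn cem ν ∧
    (∀ x, x ≠ cem → c₁ • ν ≤ condLaw cem X (P x) t₀) ∧
    (∀ z, z ≠ cem → ∀ t : ℝ≥0,
      (c₂ : ℝ≥0∞) * P z (alive X cem t) ≤ (P ∘ₘ ν) (alive X cem t))

/-- Quasi-stationary distributions: probability measures `α` on `E` with
`α = ℙ_α(X_t ∈ · | t < τ_∂)` for all `t ≥ 0`. -/
def IsQSD (cem : M) (X : ℝ≥0 → Ω → M) (P : Kernel M Ω) (α : Measure M) : Prop :=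
  IsProbOn cem α ∧ ∀ t : ℝ≥0, condLaw cem X (P ∘ₘ α) t = α

end QSD

end

/-! Everything is reduced to the killed kernels `killedKernel` Q_t(x, ·) = ℙ_x(X_t ∈ ·, t < τ_∂) and
to h_t(x) = Q_t(x, M), called `surv`. The gradient bound says that Q_{t₁} is Lipschitz in total
variation (`TVLipschitz`); applied to f = 1 it gives h_{t₁} ≤ C ρ_∂. Conversely, `exists_return`
combines the hitting hypothesis, the strong Markov property and irreducibility into Q_{2t₁}(x, K) ≥
c₀ ρ_∂(x) for some compact K ⊂ E. So survival and return to K are both controlled by ρ_∂.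

The central estimate, `exists_mul_dist_mul_surv_le`, is h_s(x) ≥ c ρ_∂(x) sup h_s uniformly in s.
The two controls give h_{t+2t₁} ≥ d h_{t+t₁}, so h_{t+2t₁} = Q_{t₁}h_{t+t₁} has Lipschitz constant
at most (C/d) sup h_{t+2t₁}. As it vanishes at ∂, it peaks away from ∂ and stays above half its
maximum on a ball of fixed radius, which K reaches with probability bounded below. Integrating the
estimate gives (A2) for every ν on E.

For (A1), `exists_minorization` finds a two-step minorization near a point x₀: truncated densities
are bounded test functions, so the two-step density is Lipschitz in the starting point. Going
through K to this neighbourhood makes it global, and h ≤ C ρ_∂ turns it into a conditional bound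
(`exists_conditional_minorization`).

(A1) and (A2) make the oscillation over x of Q_t(x, A)/h_t(x) contract geometrically
(`exists_bounds_add`). Conditional laws are averages of this ratio, so they forget the initial law;
a Cauchy argument gives the quasi-stationary distribution. In (c), the central estimate bounds sup
h_t / μ₁(h_t) by 1/(c μ₁(ρ_∂)). -/

namespace QSD

/-! ### Integrals of bounded functions -/

section BoundedIntegrals

variable {S : Type*} [MeasurableSpace S]

theorem integrable_of_abs_le (μ : Measure S) [IsFiniteMeasure μ] {f : S → ℝ} (hf : Measurable f)
    {b : ℝ} (hb : ∀ x, |f x| ≤ b) : Integrable f μ :=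
  Integrable.of_bound hf.aestronglyMeasurable b (Filter.Eventually.of_forall hb)

theorem mul_real_le_integral (μ : Measure S) [IsFiniteMeasure μ] {f : S → ℝ}
    (hfi : Integrable f μ) (h0 : ∀ x, 0 ≤ f x) {A : Set S} (hA : MeasurableSet A) {c : ℝ}
    (hc : ∀ x ∈ A, c ≤ f x) : c * μ.real A ≤ ∫ x, f x ∂μ := by
  calc c * μ.real A = μ.real A • c := by rw [smul_eq_mul, mul_comm]
    _ ≤ ∫ x in A, f x ∂μ :=
      setIntegral_ge_of_const_le hA (measure_ne_top _ _) hc hfi.integrableOn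
    _ ≤ ∫ x, f x ∂μ := setIntegral_le_integral hfi (Filter.Eventually.of_forall h0)

theorem integral_le_mul_real_univ (μ : Measure S) [IsFiniteMeasure μ] {f : S → ℝ}
    (hfi : Integrable f μ) {c : ℝ} (hc : ∀ x, f x ≤ c) : ∫ x, f x ∂μ ≤ c * μ.real Set.univ := by
  calc ∫ x, f x ∂μ ≤ ∫ _, c ∂μ := integral_mono hfi (integrable_const c) hc
    _ = c * μ.real Set.univ := by rw [integral_const, smul_eq_mul, mul_comm]

end BoundedIntegrals

/-! ### Killed semigroups and survival probabilities -/

variable {M : Type*} [MeasurableSpace M]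

/-- A semigroup of sub-Markov kernels on `M` for which the point `cem` carries no mass: the
transition kernels of a process killed when it reaches `cem`. -/
structure IsKilledSemigroup (cem : M) (Q : ℝ≥0 → Kernel M M) : Prop where
  mass_le_one : ∀ t x, Q t x Set.univ ≤ 1
  apply_cem : ∀ t x, Q t x {cem} = 0
  at_cem : ∀ t, Q t cem = 0
  comp : ∀ s t, Q (s + t) = Q t ∘ₖ Q s
  pos : ∀ t x, x ≠ cem → 0 < Q t x Set.univ

/-- The survival probability `ℙ_x(t < τ_∂)`. -/
noncomputable def surv (Q : ℝ≥0 → Kernel M M) (t : ℝ≥0) (x : M) : ℝ := (Q t x).real Set.univ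

section Semigroup

variable {cem : M} {Q : ℝ≥0 → Kernel M M}

theorem measurable_kernel_real (t : ℝ≥0) {A : Set M} (hA : MeasurableSet A) :
    Measurable fun x => (Q t x).real A :=
  ((Q t).measurable_coe hA).ennreal_toReal

theorem measurable_surv (t : ℝ≥0) : Measurable (surv Q t) :=
  ((Q t).measurable_coe MeasurableSet.univ).ennreal_toReal

theorem surv_nonneg (t : ℝ≥0) (x : M) : 0 ≤ surv Q t x := measureReal_nonneg

theorem integral_one (t : ℝ≥0) (x : M) : ∫ _, (1 : ℝ) ∂(Q t x) = surv Q t x := by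
  simp [surv]

namespace IsKilledSemigroup

variable (hQ : IsKilledSemigroup cem Q)
include hQ

theorem surv_le_one (t : ℝ≥0) (x : M) : surv Q t x ≤ 1 :=
  ENNReal.toReal_le_of_le_ofReal zero_le_one (by simpa using hQ.mass_le_one t x)

theorem surv_cem (t : ℝ≥0) : surv Q t cem = 0 := by simp [surv, hQ.at_cem]

variable [∀ t, IsFiniteKernel (Q t)]

theorem real_le_one (t : ℝ≥0) (x : M) (A : Set M) : (Q t x).real A ≤ 1 :=
  (measureReal_mono (Set.subset_univ A)).trans (hQ.surv_le_one t x)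

theorem abs_real_le_one (t : ℝ≥0) (x : M) (A : Set M) : |(Q t x).real A| ≤ 1 := by
  rw [abs_of_nonneg measureReal_nonneg]; exact hQ.real_le_one t x A

theorem abs_surv_le_one (t : ℝ≥0) (x : M) : |surv Q t x| ≤ 1 := hQ.abs_real_le_one t x _

theorem surv_pos (t : ℝ≥0) {x : M} (hx : x ≠ cem) : 0 < surv Q t x :=
  ENNReal.toReal_pos (hQ.pos t x hx).ne' (measure_ne_top _ _)

theorem integral_add (s t : ℝ≥0) (x : M) {f : M → ℝ} (hf : Measurable f) {b : ℝ}
    (hb : ∀ x, |f x| ≤ b) :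
    ∫ y, f y ∂(Q (s + t) x) = ∫ z, ∫ y, f y ∂(Q t z) ∂(Q s x) := by
  have h := integrable_of_abs_le (Q (s + t) x) hf hb
  rw [hQ.comp] at h ⊢
  exact Kernel.integral_comp h

theorem real_add (s t : ℝ≥0) (x : M) {A : Set M} (hA : MeasurableSet A) :
    (Q (s + t) x).real A = ∫ z, (Q t z).real A ∂(Q s x) := by
  have h := hQ.integral_add s t x (f := A.indicator 1) (b := 1)
    (measurable_one.indicator hA) (fun y => by by_cases hy : y ∈ A <;> simp [hy])
  simpa only [integral_indicator_one hA] using h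

theorem surv_add (s t : ℝ≥0) (x : M) : surv Q (s + t) x = ∫ z, surv Q t z ∂(Q s x) :=
  hQ.real_add s t x MeasurableSet.univ

theorem integrable_surv (t : ℝ≥0) (μ : Measure M) [IsFiniteMeasure μ] :
    Integrable (surv Q t) μ :=
  integrable_of_abs_le μ (measurable_surv t) (hQ.abs_surv_le_one t)

theorem surv_antitone {s t : ℝ≥0} (hst : s ≤ t) (x : M) : surv Q t x ≤ surv Q s x := by
  obtain ⟨u, rfl⟩ := exists_add_of_le hst
  rw [hQ.surv_add, ← one_mul (surv Q s x)]
  exact integral_le_mul_real_univ _ (hQ.integrable_surv u _) (hQ.surv_le_one u)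

/-- Chapman-Kolmogorov lower bound through a set `A`. -/
theorem mul_real_le_surv_add (s t : ℝ≥0) (x : M) {A : Set M} (hA : MeasurableSet A) {c : ℝ}
    (hc : ∀ z ∈ A, c ≤ surv Q t z) : c * (Q s x).real A ≤ surv Q (s + t) x := by
  rw [hQ.surv_add]
  exact mul_real_le_integral _ (hQ.integrable_surv t _) (surv_nonneg t) hA hc

theorem mul_real_le_real_add (s t : ℝ≥0) (x : M) {A B : Set M} (hA : MeasurableSet A)
    (hB : MeasurableSet B) {c : ℝ} (hc : ∀ z ∈ A, c ≤ (Q t z).real B) :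
    c * (Q s x).real A ≤ (Q (s + t) x).real B := by
  rw [hQ.real_add s t x hB]
  exact mul_real_le_integral _ (integrable_of_abs_le _ (measurable_kernel_real t hB)
    fun z => hQ.abs_real_le_one t z B) (fun _ => measureReal_nonneg) hA hc

end IsKilledSemigroup

end Semigroup

/-- `δ_x Q_t` is Lipschitz in `x` for the total variation norm, with constant `C`. -/
def TVLipschitz [MetricSpace M] (Q : ℝ≥0 → Kernel M M) (t : ℝ≥0) (C : ℝ) : Prop :=
  ∀ f : M → ℝ, Measurable f → ∀ b : ℝ, (∀ x, |f x| ≤ b) → ∀ x y,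
    |∫ z, f z ∂(Q t x) - ∫ z, f z ∂(Q t y)| ≤ C * b * dist x y

/-! ### Conditions (A1) and (A2) from total variation regularity -/

section Criterion

variable [MetricSpace M] {cem : M} {Q : ℝ≥0 → Kernel M M} {t₁ : ℝ≥0} {C : ℝ}

namespace TVLipschitz

theorem continuous (h : TVLipschitz Q t₁ C) (hC : 0 ≤ C) {f : M → ℝ} (hf : Measurable f) {b : ℝ}
    (hb : ∀ x, |f x| ≤ b) : Continuous fun x => ∫ z, f z ∂(Q t₁ x) := by
  rcases isEmpty_or_nonempty M with hM | ⟨⟨x⟩⟩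
  · exact continuous_of_discreteTopology
  have hb0 : 0 ≤ b := (abs_nonneg _).trans (hb x)
  refine (LipschitzWith.of_dist_le_mul (K := (C * b).toNNReal) fun x y => ?_).continuous
  rw [Real.dist_eq, Real.coe_toNNReal _ (mul_nonneg hC hb0)]
  exact h f hf b hb x y

theorem continuous_real (h : TVLipschitz Q t₁ C) (hC : 0 ≤ C) {A : Set M} (hA : MeasurableSet A) :
    Continuous fun x => (Q t₁ x).real A := by
  have := h.continuous hC (f := A.indicator 1) (b := 1)
    (measurable_one.indicator hA) (fun y => by by_cases hy : y ∈ A <;> simp [hy])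
  simpa only [integral_indicator_one hA] using this

/-- This is the Lipschitz estimate for the constant 1, compared with `cem`, where nothing survives.
-/
theorem surv_le (h : TVLipschitz Q t₁ C) (hQ : IsKilledSemigroup cem Q) (x : M) :
    surv Q t₁ x ≤ C * dist x cem := by
  have := h (fun _ => 1) measurable_const 1 (by simp) x cem
  rw [integral_one, integral_one, hQ.surv_cem, sub_zero, mul_one] at this
  exact (le_abs_self _).trans this

end TVLipschitz

variable [∀ t, IsFiniteKernel (Q t)]

theorem exists_pos_forall_le_of_isCompact {T : Type*} [TopologicalSpace T] {K : Set T}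
    (hK : IsCompact K) {f : T → ℝ} (hf : ContinuousOn f K) (h0 : ∀ x ∈ K, 0 < f x) :
    ∃ c, 0 < c ∧ ∀ x ∈ K, c ≤ f x := by
  rcases K.eq_empty_or_nonempty with rfl | hne
  · exact ⟨1, one_pos, by simp⟩
  · obtain ⟨x, hx, hmin⟩ := hK.exists_isMinOn hne hf
    exact ⟨f x, h0 x hx, fun y hy => hmin hy⟩

/-- A kernel that is Lipschitz in total variation has a dominating finite measure. -/
theorem TVLipschitz.exists_dominating [CompactSpace M] [BorelSpace M] (h : TVLipschitz Q t₁ C)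
    (hC : 0 ≤ C) (hQ : IsKilledSemigroup cem Q) :
    ∃ m : Measure M, IsFiniteMeasure m ∧ m {cem} = 0 ∧ ∀ x, Q t₁ x ≪ m := by
  have : Nonempty M := ⟨cem⟩
  let u : ℕ → M := TopologicalSpace.denseSeq M
  let m₀ : Measure M := Measure.sum fun n => Q t₁ (u n)
  refine ⟨m₀.toFinite, inferInstance, ?_, fun x => ?_⟩
  · refine toFinite_absolutelyContinuous m₀ ?_
    rw [Measure.sum_apply _ (measurableSet_singleton cem)]
    simp [hQ.apply_cem]
  · refine Measure.AbsolutelyContinuous.trans ?_ (absolutelyContinuous_toFinite m₀)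
    refine Measure.AbsolutelyContinuous.mk fun A hA h0 => ?_
    rw [Measure.sum_apply _ hA, ENNReal.tsum_eq_zero] at h0
    -- A null set of the sum is null from every point of a dense sequence, hence from every point by
    -- continuity.
    have hcl : IsClosed {x | (Q t₁ x).real A = 0} :=
      isClosed_eq (h.continuous_real hC hA) continuous_const
    have : ∀ x, (Q t₁ x).real A = 0 := by
      refine fun x => hcl.closure_subset_iff.2 ?_ (TopologicalSpace.denseRange_denseSeq M x)
      rintro _ ⟨n, rfl⟩
      simp [Measure.real, h0 n, u]
    exact (measureReal_eq_zero_iff (measure_ne_top _ _)).1 (this x)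

/-- Near any point, a kernel that is Lipschitz in total variation satisfies a two-step
minorization condition. -/
theorem TVLipschitz.exists_minorization [CompactSpace M] [BorelSpace M]
    (h : TVLipschitz Q t₁ C) (hC : 0 < C) (hQ : IsKilledSemigroup cem Q) {x₀ : M}
    (hx₀ : x₀ ≠ cem) :
    ∃ r c : ℝ, 0 < r ∧ 0 < c ∧ ∃ ν : Measure M, IsProbOn cem ν ∧
      ∀ x, dist x x₀ ≤ r → ∀ A, MeasurableSet A → c * ν.real A ≤ (Q (t₁ + t₁) x).real A := by
  obtain ⟨m, hm, hmc, hac⟩ := h.exists_dominating hC.le hQ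
  -- Truncating the density at 1 keeps it positive where it was, and makes `p · y` a test function
  -- bounded uniformly in `y`.
  let p : M → M → ℝ≥0∞ := fun z y => min ((Q t₁).rnDeriv (Kernel.const M m) z y) 1
  have hp : Measurable (Function.uncurry p) :=
    (Kernel.measurable_rnDeriv (Q t₁) (Kernel.const M m)).min measurable_const
  have hp1 : ∀ z y, p z y ≤ 1 := fun z y => min_le_right _ _
  have hac' : ∀ x, Q t₁ x ≪ Kernel.const M m x := hac
  have hpQ : ∀ z A, MeasurableSet A → ∫⁻ y in A, p z y ∂m ≤ Q t₁ z A := fun z A hA => by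
    rw [← Kernel.setLIntegral_rnDeriv (hac' z) hA]
    exact lintegral_mono fun y => min_le_left _ _
  let u : M → M → ℝ≥0∞ := fun x y => ∫⁻ z, p z y ∂(Q t₁ x)
  have hu : ∀ x, Measurable (u x) := fun x => hp.lintegral_prod_left'
  -- If `u x₀` vanished a.e., Fubini would give `p z = 0` a.e. for almost every `z` under `Q t₁ x₀`.
  -- Such a `z` has no surviving mass, so it is `cem`, which `Q t₁ x₀` does not charge.
  have hpos : m {y | u x₀ y ≠ 0} ≠ 0 := by
    intro h0
    have h1 : ∫⁻ y, u x₀ y ∂m = 0 := (lintegral_eq_zero_iff (hu x₀)).2 h0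
    rw [← lintegral_lintegral_swap hp.aemeasurable] at h1
    have h1 := (lintegral_eq_zero_iff hp.lintegral_prod_right').1 h1
    have h2 : ∀ᵐ z ∂(Q t₁ x₀), z = cem := by
      filter_upwards [h1] with z hz
      by_contra hzc
      refine (hQ.pos t₁ z hzc).ne' ?_
      rw [← Kernel.setLIntegral_rnDeriv (hac' z) MeasurableSet.univ, setLIntegral_univ,
        lintegral_eq_zero_iff (Kernel.measurable_rnDeriv_right _ _ _)]
      have hz' : ∫⁻ y, p z y ∂m = 0 := hz
      rw [lintegral_eq_zero_iff (hp.of_uncurry_left)] at hz'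
      filter_upwards [hz'] with y hy
      have : min ((Q t₁).rnDeriv (Kernel.const M m) z y) 1 = 0 := hy
      rcases min_eq_bot.1 this with h' | h'
      · exact h'
      · simp at h'
    refine (hQ.pos t₁ x₀ hx₀).ne' ?_
    have h3 : Q t₁ x₀ {cem}ᶜ = 0 := h2
    rw [← measure_add_measure_compl (measurableSet_singleton cem), h3, hQ.apply_cem, add_zero]
  -- The level is `2 * δ` so that one `δ` can be lost when moving from `x₀` to a nearby `x`.
  obtain ⟨δ, hδ, hδm⟩ : ∃ δ : ℝ, 0 < δ ∧ m {y | ENNReal.ofReal (2 * δ) < u x₀ y} ≠ 0 := by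
    by_contra! hcon
    refine hpos (measure_mono_null (fun y hy => ?_)
      (measure_iUnion_null fun n : ℕ => hcon (1 / (n + 1)) (by positivity)))
    obtain ⟨ε, hε0, hε⟩ := ENNReal.lt_iff_exists_real_btwn.1 (pos_iff_ne_zero.2 hy)
    obtain ⟨hε1, hε2⟩ := hε
    have hε3 : 0 < ε := by simpa using hε1
    obtain ⟨n, hn⟩ := exists_nat_one_div_lt (half_pos hε3)
    refine Set.mem_iUnion.2 ⟨n, lt_of_le_of_lt (ENNReal.ofReal_le_ofReal ?_) hε2⟩
    linarith
  let S : Set M := {y | ENNReal.ofReal (2 * δ) < u x₀ y}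
  have hS : MeasurableSet S := measurableSet_lt measurable_const (hu x₀)
  have hSm : 0 < m.real S := ENNReal.toReal_pos hδm (measure_ne_top _ _)
  have hureal : ∀ x y, u x y = ENNReal.ofReal (∫ z, (p z y).toReal ∂(Q t₁ x)) := fun x y => by
    have hpm : Measurable fun z => p z y := hp.of_uncurry_right
    rw [integral_toReal hpm.aemeasurable
      (Filter.Eventually.of_forall fun z => (hp1 z y).trans_lt ENNReal.one_lt_top),
      ENNReal.ofReal_toReal]
    refine (lt_of_le_of_lt (lintegral_mono fun z => hp1 z y) ?_).ne
    simp
  have hlow : ∀ x, dist x x₀ ≤ δ / C → ∀ y ∈ S, ENNReal.ofReal δ ≤ u x y := fun x hx y hy => by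
    have hy' : ENNReal.ofReal (2 * δ) < u x₀ y := hy
    rw [hureal] at hy' ⊢
    have hy2 := (ENNReal.ofReal_lt_ofReal_iff_of_nonneg (by positivity)).1 hy'
    have hL := h (fun z => (p z y).toReal) (Measurable.ennreal_toReal hp.of_uncurry_right) 1
      (fun z => by
        rw [abs_of_nonneg ENNReal.toReal_nonneg]
        exact ENNReal.toReal_le_of_le_ofReal zero_le_one (by simpa using hp1 z y)) x x₀
    have hd : C * 1 * dist x x₀ ≤ δ := by
      rw [mul_one, mul_comm]; exact (le_div_iff₀ hC).1 hx
    refine ENNReal.ofReal_le_ofReal ?_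
    have := (abs_le.1 hL).1
    linarith
  refine ⟨δ / C, δ * m.real S, div_pos hδ hC, mul_pos hδ hSm, m[|S], ⟨?_, ?_⟩, ?_⟩
  · exact cond_isProbabilityMeasure hδm
  · exact cond_absolutelyContinuous hmc
  · intro x hx A hA
    have hcond : δ * m.real S * m[|S].real A = δ * m.real (S ∩ A) := by
      rw [measureReal_def m[|S], cond_apply hS, ENNReal.toReal_mul, ENNReal.toReal_inv, mul_assoc]
      exact congrArg (δ * ·) (mul_inv_cancel_left₀ hSm.ne' _)
    have hmain : ENNReal.ofReal δ * m (S ∩ A) ≤ Q (t₁ + t₁) x A := by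
      rw [hQ.comp, Kernel.comp_apply' _ _ _ hA]
      calc ENNReal.ofReal δ * m (S ∩ A) = ∫⁻ _ in S ∩ A, ENNReal.ofReal δ ∂m := by simp
        _ ≤ ∫⁻ y in S ∩ A, u x y ∂m :=
          setLIntegral_mono (hu x) fun y hy => hlow x hx y hy.1
        _ ≤ ∫⁻ y in A, u x y ∂m := lintegral_mono_set Set.inter_subset_right
        _ = ∫⁻ z, ∫⁻ y in A, p z y ∂m ∂(Q t₁ x) :=
          (lintegral_lintegral_swap hp.aemeasurable).symm
        _ ≤ ∫⁻ z, Q t₁ z A ∂(Q t₁ x) := lintegral_mono fun z => hpQ z A hA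
    rw [hcond]
    have := ENNReal.toReal_mono (measure_ne_top _ _) hmain
    rwa [ENNReal.toReal_mul, ENNReal.toReal_ofReal hδ.le] at this

/-- A compact set not containing `cem` reaches, at time `t₁`, all balls of a given radius centered
in another such set with a probability bounded below. -/
theorem TVLipschitz.exists_le_real_closedBall [BorelSpace M] (h : TVLipschitz Q t₁ C)
    (hC : 0 ≤ C)
    (hR : ∀ x y, x ≠ cem → y ≠ cem → ∀ r : ℝ, 0 < r → 0 < (Q t₁ x).real (Metric.closedBall y r))
    {K L : Set M} (hK : IsCompact K) (hKc : cem ∉ K) (hL : IsCompact L) (hLc : cem ∉ L)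
    {r : ℝ} (hr : 0 < r) :
    ∃ c, 0 < c ∧ ∀ z ∈ L, ∀ x ∈ K, c ≤ (Q t₁ x).real (Metric.closedBall z r) := by
  -- The bound is local in the centre `z`: near `z₀`, the ball of radius `r` around `z` contains the
  -- ball of radius `r / 2` around `z₀`.
  refine hL.induction_on (p := fun L => ∃ c, 0 < c ∧ ∀ z ∈ L, ∀ x ∈ K,
    c ≤ (Q t₁ x).real (Metric.closedBall z r)) ⟨1, one_pos, by simp⟩ ?_ ?_ ?_
  · rintro s t hst ⟨c, hc, H⟩
    exact ⟨c, hc, fun z hz => H z (hst hz)⟩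
  · rintro s t ⟨c, hc, H⟩ ⟨c', hc', H'⟩
    refine ⟨min c c', lt_min hc hc', fun z hz x hx => ?_⟩
    rcases hz with hz | hz
    · exact (min_le_left _ _).trans (H z hz x hx)
    · exact (min_le_right _ _).trans (H' z hz x hx)
  · intro z₀ hz₀
    obtain ⟨c, hc, H⟩ := exists_pos_forall_le_of_isCompact hK
      (h.continuous_real hC
        (Metric.isClosed_closedBall (x := z₀) (ε := r / 2)).measurableSet).continuousOn
      (fun x hx => hR x z₀ (fun e => hKc (e ▸ hx)) (fun e => hLc (e ▸ hz₀)) _ (half_pos hr))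
    refine ⟨Metric.closedBall z₀ (r / 2),
      mem_nhdsWithin_of_mem_nhds (Metric.closedBall_mem_nhds _ (half_pos hr)), c, hc, ?_⟩
    intro z hz x hx
    refine (H x hx).trans (measureReal_mono (Metric.closedBall_subset_closedBall' ?_))
    rw [dist_comm]
    have : dist z z₀ ≤ r / 2 := hz
    linarith

/-- Survival from a fixed compact set is comparable, uniformly in time, to the best survival
probability. -/
theorem TVLipschitz.exists_mul_surv_le_of_mem [CompactSpace M] [BorelSpace M]
    (h : TVLipschitz Q t₁ C) (hC : 0 < C) (hQ : IsKilledSemigroup cem Q) (hE : ∃ x : M, x ≠ cem)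
    (hR : ∀ x y, x ≠ cem → y ≠ cem → ∀ r : ℝ, 0 < r → 0 < (Q t₁ x).real (Metric.closedBall y r))
    {K : Set M} (hK : IsCompact K) (hKc : cem ∉ K) {c₀ : ℝ} (hc₀ : 0 < c₀)
    (hret : ∀ x, c₀ * dist x cem ≤ (Q (t₁ + t₁) x).real K) :
    ∃ c, 0 < c ∧ ∀ s x z, x ∈ K → c * surv Q s z ≤ surv Q s x := by
  have hKm := hK.measurableSet
  -- the survival probability decreases at most geometrically
  obtain ⟨d, hd, hdec⟩ : ∃ d, 0 < d ∧
      ∀ t x, d * surv Q (t + t₁) x ≤ surv Q (t + t₁ + t₁) x := by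
    obtain ⟨a, ha, Ha⟩ := exists_pos_forall_le_of_isCompact hK
      (h.continuous_real hC.le MeasurableSet.univ).continuousOn
      (fun x hx => hQ.surv_pos t₁ (fun e => hKc (e ▸ hx)))
    refine ⟨a * (c₀ / C), by positivity, fun t x => ?_⟩
    -- At time `t`, being able to survive `t₁` more forces distance from `cem`, hence a return to
    -- `K` within `t₁ + t₁`. From `K`, survival for `t₁` more costs only the factor `a`.
    have h1 : c₀ / C * surv Q (t + t₁) x ≤ (Q (t + (t₁ + t₁)) x).real K := by
      rw [hQ.real_add t (t₁ + t₁) x hKm, hQ.surv_add, ← integral_const_mul]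
      refine integral_mono ((hQ.integrable_surv t₁ _).const_mul _)
        (integrable_of_abs_le _ (measurable_kernel_real _ hKm)
          fun z => hQ.abs_real_le_one _ z K) fun z => ?_
      calc c₀ / C * surv Q t₁ z ≤ c₀ / C * (C * dist z cem) := by
            gcongr; exact h.surv_le hQ z
        _ = c₀ * dist z cem := by field_simp
        _ ≤ _ := hret z
    calc a * (c₀ / C) * surv Q (t + t₁) x = a * (c₀ / C * surv Q (t + t₁) x) := by ring
      _ ≤ a * (Q (t + (t₁ + t₁)) x).real K := by gcongr
      _ ≤ surv Q (t + (t₁ + t₁) + t₁) x := hQ.mul_real_le_surv_add _ _ _ hKm Ha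
      _ ≤ surv Q (t + t₁ + t₁) x := hQ.surv_antitone (by rw [add_assoc t]; exact le_self_add) x
  -- a ball on which survival is at least half the best one
  let r : ℝ := d / (2 * C)
  have hr : 0 < r := by positivity
  let L : Set M := {z | 2 * r ≤ dist z cem}
  have hL : IsCompact L := (isClosed_le continuous_const (by fun_prop)).isCompact
  have hLc : cem ∉ L := by simp [L, hr]
  obtain ⟨c, hc, Hc⟩ := h.exists_le_real_closedBall hC.le hR hK hKc hL hLc hr
  have hbig : ∀ t x z, x ∈ K → c / 2 * surv Q (t + t₁ + t₁) z ≤ surv Q (t + t₁ + t₁ + t₁) x := by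
    intro t x z hx
    have : Nonempty M := ⟨x⟩
    have hF : ∀ y, surv Q (t + t₁ + t₁) y = ∫ w, surv Q (t + t₁) w ∂(Q t₁ y) := fun y => by
      rw [← hQ.surv_add, add_comm]
    have hFc : Continuous (surv Q (t + t₁ + t₁)) := by
      rw [funext hF]
      exact h.continuous hC.le (measurable_surv _) (hQ.abs_surv_le_one _)
    obtain ⟨z₀, -, hz₀⟩ := isCompact_univ.exists_isMaxOn Set.univ_nonempty hFc.continuousOn
    have hmax : ∀ y, surv Q (t + t₁ + t₁) y ≤ surv Q (t + t₁ + t₁) z₀ :=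
      fun y => hz₀ (Set.mem_univ y)
    set H := surv Q (t + t₁ + t₁) z₀ with hH
    have hHpos : 0 < H := by
      obtain ⟨e, he⟩ := hE
      exact (hQ.surv_pos _ he).trans_le (hmax e)
    -- The function is the image under `Q t₁` of `surv Q (t + t₁)`, which `hdec` bounds by `H / d`.
    have hLip : ∀ y, |surv Q (t + t₁ + t₁) y - H| ≤ C * (H / d) * dist y z₀ := fun y => by
      rw [hF y, hH, hF z₀, ← hF z₀, ← hH]
      nth_rw 1 [hH, hF z₀]
      refine h _ (measurable_surv _) _ (fun w => ?_) _ _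
      rw [abs_of_nonneg (surv_nonneg _ _), le_div_iff₀ hd, mul_comm]
      exact (hdec t w).trans (hmax w)
    have hCr : C * (H / d) * r = H / 2 := by
      simp only [r]; field_simp
    -- The function is 0 at `cem` and `H` at `z₀`, so the Lipschitz bound keeps `z₀` at distance at
    -- least `2 * r` from `cem`.
    have hz₀L : z₀ ∈ L := by
      have := hLip cem
      rw [hQ.surv_cem, zero_sub, abs_neg, abs_of_pos hHpos, dist_comm] at this
      have h2 : C * (H / d) * (2 * r) ≤ C * (H / d) * dist z₀ cem := by
        calc C * (H / d) * (2 * r) = H := by linarith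
          _ ≤ _ := this
      exact le_of_mul_le_mul_left h2 (by positivity)
    have hball : ∀ y ∈ Metric.closedBall z₀ r, H / 2 ≤ surv Q (t + t₁ + t₁) y := fun y hy => by
      have h1 := (abs_le.1 (hLip y)).1
      have h2 : C * (H / d) * dist y z₀ ≤ C * (H / d) * r := by
        gcongr; exact hy
      linarith
    calc c / 2 * surv Q (t + t₁ + t₁) z ≤ c / 2 * H := by gcongr; exact hmax z
      _ = H / 2 * c := by ring
      _ ≤ H / 2 * (Q t₁ x).real (Metric.closedBall z₀ r) := by
        gcongr; exact Hc z₀ hz₀L x hx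
      _ ≤ surv Q (t₁ + (t + t₁ + t₁)) x :=
        hQ.mul_real_le_surv_add _ _ _ Metric.isClosed_closedBall.measurableSet hball
      _ = surv Q (t + t₁ + t₁ + t₁) x := by rw [add_comm t₁]
  obtain ⟨e, he⟩ := hE
  let T : ℝ≥0 := t₁ + t₁ + t₁
  have hT : ∀ x z, x ∈ K → c / 2 * surv Q T z ≤ surv Q T x := fun x z hx => by
    have := hbig 0 x z hx
    rw [zero_add] at this
    refine le_trans ?_ this
    gcongr
    exact hQ.surv_antitone le_self_add z
  have heT := hQ.surv_pos T he
  -- The second constant serves times below `T`, where the left survival is at most 1 and the right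
  -- one is at least its value at `T`.
  refine ⟨min (c / 2) (c / 2 * surv Q T e), by positivity, fun s x z hx => ?_⟩
  rcases le_total T s with hs | hs
  · obtain ⟨t, rfl⟩ := exists_add_of_le hs
    have := hbig t x z hx
    rw [show T + t = t + t₁ + t₁ + t₁ by simp only [T]; ring]
    refine le_trans (mul_le_mul (min_le_left _ _) (hQ.surv_antitone le_self_add z)
      (surv_nonneg _ _) (by positivity)) this
  · calc min (c / 2) (c / 2 * surv Q T e) * surv Q s z ≤ c / 2 * surv Q T e * 1 :=
          mul_le_mul (min_le_right _ _) (hQ.surv_le_one _ _) (surv_nonneg _ _) (by positivity)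
      _ ≤ surv Q T x := by rw [mul_one]; exact hT x e hx
      _ ≤ surv Q s x := hQ.surv_antitone hs x

/-- The survival probability `h_s` satisfies `h_s(x) ≥ c ρ_∂(x) sup h_s`, uniformly in `s`. -/
theorem TVLipschitz.exists_mul_dist_mul_surv_le [CompactSpace M] [BorelSpace M]
    (h : TVLipschitz Q t₁ C) (hC : 0 < C) (hQ : IsKilledSemigroup cem Q) (hE : ∃ x : M, x ≠ cem)
    (hR : ∀ x y, x ≠ cem → y ≠ cem → ∀ r : ℝ, 0 < r → 0 < (Q t₁ x).real (Metric.closedBall y r))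
    {K : Set M} (hK : IsCompact K) (hKc : cem ∉ K) {c₀ : ℝ} (hc₀ : 0 < c₀)
    (hret : ∀ x, c₀ * dist x cem ≤ (Q (t₁ + t₁) x).real K) :
    ∃ c, 0 < c ∧ ∀ s x z, c * dist x cem * surv Q s z ≤ surv Q s x := by
  obtain ⟨c, hc, H⟩ := h.exists_mul_surv_le_of_mem hC hQ hE hR hK hKc hc₀ hret
  refine ⟨c * c₀, by positivity, fun s x z => ?_⟩
  calc c * c₀ * dist x cem * surv Q s z = c * surv Q s z * (c₀ * dist x cem) := by ring
    _ ≤ c * surv Q s z * (Q (t₁ + t₁) x).real K := by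
      gcongr
      · exact mul_nonneg hc.le (surv_nonneg _ _)
      · exact hret x
    _ ≤ surv Q (t₁ + t₁ + s) x :=
      hQ.mul_real_le_surv_add _ _ _ hK.measurableSet fun y hy => H s y z hy
    _ ≤ surv Q s x := hQ.surv_antitone le_add_self x

/-- Condition (A1) in terms of the killed semigroup. -/
theorem TVLipschitz.exists_conditional_minorization [CompactSpace M] [BorelSpace M]
    (h : TVLipschitz Q t₁ C) (hC : 0 < C) (ht₁ : 0 < t₁) (hQ : IsKilledSemigroup cem Q)
    (hE : ∃ x : M, x ≠ cem)
    (hR : ∀ x y, x ≠ cem → y ≠ cem → ∀ r : ℝ, 0 < r → 0 < (Q t₁ x).real (Metric.closedBall y r))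
    {K : Set M} (hK : IsCompact K) (hKc : cem ∉ K) {c₀ : ℝ} (hc₀ : 0 < c₀)
    (hret : ∀ x, c₀ * dist x cem ≤ (Q (t₁ + t₁) x).real K) :
    ∃ t₀ : ℝ≥0, 0 < t₀ ∧ ∃ c, 0 < c ∧ ∃ ν : Measure M, IsProbOn cem ν ∧
      ∀ x A, MeasurableSet A → c * surv Q t₀ x * ν.real A ≤ (Q t₀ x).real A := by
  obtain ⟨x₀, hx₀⟩ := hE
  obtain ⟨r, a, hr, ha, ν, hν, H⟩ := h.exists_minorization hC hQ hx₀
  obtain ⟨b, hb, Hb⟩ := exists_pos_forall_le_of_isCompact hK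
      (h.continuous_real hC.le
        (Metric.isClosed_closedBall (x := x₀) (ε := r)).measurableSet).continuousOn
      (fun x hx => hR x x₀ (fun e => hKc (e ▸ hx)) hx₀ _ hr)
  -- Two steps of length `t₁` reach `K`, one goes from `K` to the ball around `x₀`, and two more
  -- apply the local minorization.
  refine ⟨t₁ + t₁ + t₁ + (t₁ + t₁), by positivity, a * b * (c₀ / C), by positivity, ν, hν,
    fun x A hA => ?_⟩
  have h1 : c₀ / C * surv Q (t₁ + t₁ + t₁ + (t₁ + t₁)) x ≤ (Q (t₁ + t₁) x).real K := by
    calc c₀ / C * surv Q (t₁ + t₁ + t₁ + (t₁ + t₁)) x ≤ c₀ / C * (C * dist x cem) := by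
          gcongr
          exact (hQ.surv_antitone (by rw [add_assoc, add_assoc]; exact le_self_add) x).trans
            (h.surv_le hQ x)
      _ = c₀ * dist x cem := by field_simp
      _ ≤ _ := hret x
  calc a * b * (c₀ / C) * surv Q (t₁ + t₁ + t₁ + (t₁ + t₁)) x * ν.real A
      = a * ν.real A * (b * (c₀ / C * surv Q (t₁ + t₁ + t₁ + (t₁ + t₁)) x)) := by ring
    _ ≤ a * ν.real A * (b * (Q (t₁ + t₁) x).real K) := by gcongr
    _ ≤ a * ν.real A * (Q (t₁ + t₁ + t₁) x).real (Metric.closedBall x₀ r) := by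
      gcongr
      exact hQ.mul_real_le_real_add _ _ _ hK.measurableSet
        Metric.isClosed_closedBall.measurableSet Hb
    _ ≤ (Q (t₁ + t₁ + t₁ + (t₁ + t₁)) x).real A :=
      hQ.mul_real_le_real_add _ _ _ Metric.isClosed_closedBall.measurableSet hA
        fun w hw => H w hw A hA

end Criterion

/-! ### Total variation distance -/

section TotalVariation

variable {S : Type*} [MeasurableSpace S]

theorem tvDist_comm (μ ν : Measure S) [IsFiniteMeasure μ] [IsFiniteMeasure ν] :
    tvDist μ ν = tvDist ν μ := by
  rw [tvDist, tvDist, ← neg_sub ν.toSignedMeasure, SignedMeasure.totalVariation_neg]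

theorem tvDist_nonneg (μ ν : Measure S) [IsFiniteMeasure μ] [IsFiniteMeasure ν] :
    0 ≤ tvDist μ ν := measureReal_nonneg

/-- On a Hahn decomposition, the total variation is the difference on the positive set minus the
difference on its complement; each contributes at most `ε`. -/
theorem tvDist_le_two_mul {μ ν : Measure S} [IsFiniteMeasure μ] [IsFiniteMeasure ν] {ε : ℝ}
    (h : ∀ A, MeasurableSet A → |μ.real A - ν.real A| ≤ ε) : tvDist μ ν ≤ 2 * ε := by
  obtain ⟨i, hi, hp, hn, h1, h2⟩ :=
    (μ.toSignedMeasure - ν.toSignedMeasure).toJordanDecomposition_spec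
  rw [tvDist, SignedMeasure.totalVariation, measureReal_add_apply, h1, h2,
    SignedMeasure.toMeasureOfZeroLE_real_apply _ hp hi MeasurableSet.univ,
    SignedMeasure.toMeasureOfLEZero_real_apply _ hn hi.compl MeasurableSet.univ,
    Set.inter_univ, Set.inter_univ, Measure.toSignedMeasure_sub_apply hi,
    Measure.toSignedMeasure_sub_apply hi.compl]
  have ha := (abs_le.1 (h i hi)).2
  have hb := (abs_le.1 (h iᶜ hi.compl)).1
  linarith

theorem abs_integral_sub_le_mul_tvDist {μ ν : Measure S} [IsFiniteMeasure μ] [IsFiniteMeasure ν]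
    {f : S → ℝ} (hf : Measurable f) {b : ℝ} (hb : ∀ x, |f x| ≤ b) :
    |∫ x, f x ∂μ - ∫ x, f x ∂ν| ≤ b * tvDist μ ν := by
  set J := (μ.toSignedMeasure - ν.toSignedMeasure).toJordanDecomposition with hJ
  have hs : J.posPart.toSignedMeasure - J.negPart.toSignedMeasure =
      μ.toSignedMeasure - ν.toSignedMeasure :=
    (μ.toSignedMeasure - ν.toSignedMeasure).toSignedMeasure_toJordanDecomposition
  -- The Jordan decomposition becomes an equality of positive measures, so that ordinary integrals
  -- can be added.
  have hm : μ + J.negPart = ν + J.posPart := by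
    rw [← Measure.toSignedMeasure_eq_toSignedMeasure_iff, Measure.toSignedMeasure_add,
      Measure.toSignedMeasure_add, ← sub_eq_zero]
    rw [← sub_eq_zero] at hs
    rw [← neg_zero, ← hs]
    abel
  have hI := congrArg (fun m : Measure S => ∫ x, f x ∂m) hm
  have hint : ∀ (m : Measure S) [IsFiniteMeasure m], Integrable f m :=
    fun m _ => integrable_of_abs_le m hf hb
  simp only [integral_add_measure (hint _) (hint _)] at hI
  have hbd : ∀ (m : Measure S) [IsFiniteMeasure m], |∫ x, f x ∂m| ≤ b * m.real Set.univ :=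
    fun m _ => norm_integral_le_of_norm_le_const (f := f) (C := b)
      (Filter.Eventually.of_forall fun y => hb y)
  have h1 : ∫ x, f x ∂μ - ∫ x, f x ∂ν = ∫ x, f x ∂J.posPart - ∫ x, f x ∂J.negPart := by linarith
  have h2 : tvDist μ ν = J.posPart.real Set.univ + J.negPart.real Set.univ := by
    rw [tvDist, SignedMeasure.totalVariation, measureReal_add_apply]
  rw [h1, h2, mul_add]
  exact (abs_sub _ _).trans (add_le_add (hbd _) (hbd _))

/-- A sequence of probability measures that is Cauchy in total variation converges setwise,
uniformly, to a probability measure. -/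
theorem exists_isProbabilityMeasure_of_cauchy {μ : ℕ → Measure S}
    [∀ n, IsProbabilityMeasure (μ n)] {ε : ℕ → ℝ} (hε : Filter.Tendsto ε Filter.atTop (nhds 0))
    (h : ∀ n k A, MeasurableSet A → |(μ (n + k)).real A - (μ n).real A| ≤ ε n) :
    ∃ α : Measure S, IsProbabilityMeasure α ∧
      ∀ n A, MeasurableSet A → |(μ n).real A - α.real A| ≤ ε n := by
  have hlim : ∀ A, MeasurableSet A →
      ∃ l, Filter.Tendsto (fun n => (μ n).real A) Filter.atTop (nhds l) := fun A hA => by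
    refine cauchySeq_tendsto_of_complete (cauchySeq_of_le_tendsto_0 (fun n => 2 * ε n) ?_ ?_)
    · intro n m N hn hm
      obtain ⟨i, rfl⟩ := exists_add_of_le hn
      obtain ⟨j, rfl⟩ := exists_add_of_le hm
      rw [Real.dist_eq]
      have h1 := h N i A hA
      have h2 := h N j A hA
      rw [abs_le] at h1 h2 ⊢
      constructor <;> linarith
    · simpa using hε.const_mul 2
  choose! L hL using hlim
  have hL0 : ∀ A, MeasurableSet A → 0 ≤ L A := fun A hA =>
    ge_of_tendsto' (hL A hA) fun n => measureReal_nonneg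
  have hLle : ∀ n A, MeasurableSet A → |L A - (μ n).real A| ≤ ε n := fun n A hA => by
    have h1 : Filter.Tendsto (fun k => (μ (n + k)).real A) Filter.atTop (nhds (L A)) := by
      have := (Filter.tendsto_add_atTop_iff_nat n).2 (hL A hA)
      simpa only [add_comm n] using this
    exact le_of_tendsto' ((h1.sub_const _).abs) fun k => h n k A hA
  have hLe : L ∅ = 0 := tendsto_nhds_unique (hL ∅ MeasurableSet.empty) (by simp)
  have hLu : L Set.univ = 1 := tendsto_nhds_unique (hL _ MeasurableSet.univ) (by simp)
  have hsum : ∀ f : ℕ → Set S, (∀ i, MeasurableSet (f i)) → Pairwise (Function.onFun Disjoint f) →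
      HasSum (fun i => L (f i)) (L (⋃ i, f i)) := fun f hf hd => by
    have hfin : ∀ (n : ℕ) (s : Finset ℕ),
        ∑ i ∈ s, (μ n).real (f i) = (μ n).real (⋃ i ∈ s, f i) := fun n s =>
      (measureReal_biUnion_finset (fun i _ j _ hij => hd hij) fun i _ => hf i).symm
    have hLfin : ∀ s : Finset ℕ, ∑ i ∈ s, L (f i) = L (⋃ i ∈ s, f i) := fun s => by
      refine tendsto_nhds_unique (tendsto_finsetSum s fun i _ => hL _ (hf i)) ?_
      simp_rw [hfin]
      exact hL _ (Finset.measurableSet_biUnion s fun i _ => hf i)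
    -- Countable additivity of `L` is an exchange of limits: convergence in `n` is uniform over all
    -- finite partial unions.
    refine TendstoUniformly.tendsto_of_eventually_tendsto (p := Filter.atTop)
      (F := fun n (s : Finset ℕ) => ∑ i ∈ s, (μ n).real (f i))
      (L := fun n => (μ n).real (⋃ i, f i)) ?_ (Filter.Eventually.of_forall fun n => ?_)
      (hL _ (MeasurableSet.iUnion hf))
    · rw [Metric.tendstoUniformly_iff]
      intro e he
      filter_upwards [hε.eventually_lt_const he] with n hn s
      rw [hLfin, hfin, Real.dist_eq]
      exact (hLle n _ (Finset.measurableSet_biUnion s fun i _ => hf i)).trans_lt hn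
    · have h1 := measure_iUnion (μ := μ n) hd hf
      have h2 : Summable fun i => (μ n).real (f i) :=
        ENNReal.summable_toReal (by rw [← h1]; exact measure_ne_top _ _)
      have h3 : (μ n).real (⋃ i, f i) = ∑' i, (μ n).real (f i) := by
        rw [measureReal_def, h1, ENNReal.tsum_toReal_eq fun i => measure_ne_top _ _]
        rfl
      rw [h3]
      exact h2.hasSum
  let α : Measure S := Measure.ofMeasurable (fun A _ => ENNReal.ofReal (L A)) (by simp [hLe])
    fun f hf hd => by
      rw [← (hsum f hf hd).tsum_eq,
        ENNReal.ofReal_tsum_of_nonneg (fun i => hL0 _ (hf i)) (hsum f hf hd).summable]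
  have hα : ∀ A, MeasurableSet A → α A = ENNReal.ofReal (L A) := fun A hA =>
    Measure.ofMeasurable_apply A hA
  refine ⟨α, ⟨by rw [hα _ MeasurableSet.univ, hLu, ENNReal.ofReal_one]⟩, fun n A hA => ?_⟩
  rw [measureReal_def α, hα A hA, ENNReal.toReal_ofReal (hL0 A hA), abs_sub_comm]
  exact hLle n A hA

end TotalVariation

/-! ### Conditioned evolution and its Doeblin contraction -/

section Evolution

variable {M : Type*} [MeasurableSpace M] {cem : M} {Q : ℝ≥0 → Kernel M M}

/-- The law of the killed process at time `t`, conditioned on survival, for the initial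
distribution `μ`. -/
noncomputable def condEvol (Q : ℝ≥0 → Kernel M M) (t : ℝ≥0) (μ : Measure M) : Measure M :=
  ((Q t ∘ₘ μ) Set.univ)⁻¹ • (Q t ∘ₘ μ)

variable [∀ t, IsFiniteKernel (Q t)]

theorem comp_real_apply (μ : Measure M) [IsFiniteMeasure μ] (t : ℝ≥0) {A : Set M}
    (hA : MeasurableSet A) : (Q t ∘ₘ μ).real A = ∫ x, (Q t x).real A ∂μ := by
  have h := integrable_of_abs_le (Q t ∘ₘ μ) (f := A.indicator 1) (b := 1)
    (measurable_one.indicator hA) (fun y => by by_cases hy : y ∈ A <;> simp [hy])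
  have h1 := integral_indicator_one (μ := Q t ∘ₘ μ) hA
  rw [← h1]
  rw [Measure.comp_eq_comp_const_apply] at h ⊢
  rw [Kernel.integral_comp h]
  simp only [integral_indicator_one hA, Kernel.const_apply]

theorem condEvol_real (μ : Measure M) [IsFiniteMeasure μ] (t : ℝ≥0) {A : Set M}
    (hA : MeasurableSet A) :
    (condEvol Q t μ).real A = (∫ x, (Q t x).real A ∂μ) / ∫ x, surv Q t x ∂μ := by
  rw [condEvol, measureReal_ennreal_smul_apply, ENNReal.toReal_inv, ← measureReal_def,
    comp_real_apply μ t hA, comp_real_apply μ t MeasurableSet.univ, inv_mul_eq_div]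
  rfl

namespace IsKilledSemigroup

variable (hQ : IsKilledSemigroup cem Q)
include hQ

theorem integral_condEvol {μ : Measure M} [IsFiniteMeasure μ] (s t : ℝ≥0) {A : Set M}
    (hA : MeasurableSet A) :
    ∫ x, (Q t x).real A ∂(condEvol Q s μ) =
      (∫ x, (Q (s + t) x).real A ∂μ) / ∫ x, surv Q s x ∂μ := by
  have hm := measurable_kernel_real (Q := Q) t hA
  have h := integrable_of_abs_le (Q s ∘ₘ μ) hm (fun z => hQ.abs_real_le_one t z A)
  have h0 : ((Q s ∘ₘ μ) Set.univ).toReal = ∫ x, surv Q s x ∂μ :=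
    comp_real_apply μ s MeasurableSet.univ
  rw [condEvol, integral_smul_measure, ENNReal.toReal_inv, h0, smul_eq_mul, inv_mul_eq_div]
  congr 1
  rw [Measure.comp_eq_comp_const_apply] at h ⊢
  rw [Kernel.integral_comp h]
  simp only [hQ.real_add s t _ hA, Kernel.const_apply]

variable [MeasurableSingletonClass M]

theorem integral_surv_pos {μ : Measure M} (hμ : IsProbOn cem μ) (t : ℝ≥0) :
    0 < ∫ x, surv Q t x ∂μ := by
  have := hμ.1
  rw [integral_pos_iff_support_of_nonneg (surv_nonneg t) (hQ.integrable_surv t μ)]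
  have h1 : μ {cem}ᶜ = 1 := (prob_compl_eq_one_iff (measurableSet_singleton cem)).2 hμ.2
  refine lt_of_lt_of_le (by rw [h1]; exact one_pos) (measure_mono (s := {cem}ᶜ) fun x hx => ?_)
  exact (hQ.surv_pos t hx).ne'

theorem isProbOn_condEvol {μ : Measure M} (hμ : IsProbOn cem μ) (t : ℝ≥0) :
    IsProbOn cem (condEvol Q t μ) := by
  have := hμ.1
  have hpos := hQ.integral_surv_pos hμ t
  have h0 : (Q t ∘ₘ μ).real Set.univ = ∫ x, surv Q t x ∂μ := comp_real_apply μ t MeasurableSet.univ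
  refine ⟨⟨?_⟩, ?_⟩
  · rw [condEvol, Measure.smul_apply, smul_eq_mul, ENNReal.inv_mul_cancel _ (measure_ne_top _ _)]
    intro h
    rw [measureReal_def, h] at h0
    exact hpos.ne h0
  · rw [condEvol, Measure.smul_apply]
    have : (Q t ∘ₘ μ) {cem} = 0 := by
      rw [Measure.bind_apply (measurableSet_singleton cem) (Q t).aemeasurable]
      simp [hQ.apply_cem]
    rw [this, smul_zero]

theorem condEvol_condEvol_real {μ : Measure M} (hμ : IsProbOn cem μ) (s t : ℝ≥0) {A : Set M}
    (hA : MeasurableSet A) :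
    (condEvol Q t (condEvol Q s μ)).real A = (condEvol Q (s + t) μ).real A := by
  have := hμ.1
  have := (hQ.isProbOn_condEvol hμ s).1
  have h := hQ.integral_condEvol (μ := μ) s t MeasurableSet.univ
  rw [condEvol_real _ t hA, hQ.integral_condEvol s t hA]
  change ∫ x, surv Q t x ∂(condEvol Q s μ) = (∫ x, surv Q (s + t) x ∂μ) / _ at h
  rw [h, div_div_div_cancel_right₀ (hQ.integral_surv_pos hμ s).ne', condEvol_real _ _ hA]

/-- One step of Doeblin contraction for the process conditioned on survival. -/
theorem exists_bounds_add {t₀ T : ℝ≥0} {c₁ c₂ κ : ℝ} (hc₁ : 0 < c₁)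
    (hκ : κ ≤ c₁ * c₂) {ν : Measure M} (hν : IsProbOn cem ν)
    (hmin : ∀ x A, MeasurableSet A → c₁ * surv Q t₀ x * ν.real A ≤ (Q t₀ x).real A)
    (hsurv : ∀ s z, c₂ * surv Q s z ≤ ∫ x, surv Q s x ∂ν) {A : Set M} (hA : MeasurableSet A)
    {a b : ℝ}
    (hab : ∀ x, a * surv Q T x ≤ (Q T x).real A ∧ (Q T x).real A ≤ b * surv Q T x) :
    ∃ a' b', b' - a' = (1 - κ) * (b - a) ∧ ∀ x, a' * surv Q (t₀ + T) x ≤ (Q (t₀ + T) x).real A ∧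
      (Q (t₀ + T) x).real A ≤ b' * surv Q (t₀ + T) x := by
  have := hν.1
  have hN := hQ.integral_surv_pos hν T
  set N := ∫ x, surv Q T x ∂ν with hNdef
  -- This is (A2) at time `T` integrated against `Q t₀ x`.
  have hupper : ∀ x, c₂ * surv Q (t₀ + T) x ≤ N * surv Q t₀ x := fun x => by
    rw [hQ.surv_add, ← integral_const_mul]
    exact integral_le_mul_real_univ _ ((hQ.integrable_surv T _).const_mul _) (hsurv T)
  have hintA : ∀ (m : Measure M) [IsFiniteMeasure m], Integrable (fun z => (Q T z).real A) m :=
    fun m _ => integrable_of_abs_le m (measurable_kernel_real T hA)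
      fun z => hQ.abs_real_le_one T z A
  have hmeas : ∀ x, ENNReal.ofReal (c₁ * surv Q t₀ x) • ν ≤ Q t₀ x := fun x => by
    refine Measure.le_iff.2 fun B hB => ?_
    have h := hmin x B hB
    rw [Measure.smul_apply, smul_eq_mul, ← ENNReal.ofReal_toReal (measure_ne_top ν B),
      ← ENNReal.ofReal_mul (mul_nonneg hc₁.le (surv_nonneg _ _)),
      ENNReal.ofReal_le_iff_le_toReal (measure_ne_top _ _)]
    exact h
  -- (A1) bounds the integral below by `c₁ * surv Q t₀ x` times the `ν`-integral; `hupper` then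
  -- trades survival up to `t₀` for survival up to `t₀ + T`.
  have hstep : ∀ g : M → ℝ, (∀ m : Measure M, IsFiniteMeasure m → Integrable g m) →
      (∀ z, 0 ≤ g z) → ∀ x,
      κ * ((∫ z, g z ∂ν) / N) * surv Q (t₀ + T) x ≤ ∫ z, g z ∂(Q t₀ x) := fun g hg hg0 x => by
    have hI : 0 ≤ ∫ z, g z ∂ν := integral_nonneg hg0
    have h1 : c₁ * surv Q t₀ x * ∫ z, g z ∂ν ≤ ∫ z, g z ∂(Q t₀ x) := by
      have := integral_mono_measure (hmeas x) (Filter.Eventually.of_forall hg0) (hg _ inferInstance)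
      rwa [integral_smul_measure, smul_eq_mul,
        ENNReal.toReal_ofReal (mul_nonneg hc₁.le (surv_nonneg _ _))] at this
    have h2 := surv_nonneg (Q := Q) (t₀ + T) x
    calc κ * ((∫ z, g z ∂ν) / N) * surv Q (t₀ + T) x
        ≤ c₁ * c₂ * ((∫ z, g z ∂ν) / N) * surv Q (t₀ + T) x := by gcongr
      _ = c₁ * ((∫ z, g z ∂ν) / N) * (c₂ * surv Q (t₀ + T) x) := by ring
      _ ≤ c₁ * ((∫ z, g z ∂ν) / N) * (N * surv Q t₀ x) :=
        mul_le_mul_of_nonneg_left (hupper x) (by positivity)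
      _ = c₁ * surv Q t₀ x * ∫ z, g z ∂ν := by field_simp
      _ ≤ _ := h1
  have hlow := hstep (fun z => (Q T z).real A - a * surv Q T z)
    (fun m _ => (hintA m).sub ((hQ.integrable_surv T m).const_mul a))
    (fun z => sub_nonneg.2 (hab z).1)
  have hup := hstep (fun z => b * surv Q T z - (Q T z).real A)
    (fun m _ => ((hQ.integrable_surv T m).const_mul b).sub (hintA m))
    (fun z => sub_nonneg.2 (hab z).2)
  -- The two nonnegative gaps sum to `(b - a) * surv Q T`, whose `ν`-integral is `(b - a) * N`;
  -- hence the two gains together remove exactly `κ * (b - a)`.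
  refine ⟨a + κ * ((∫ z, ((Q T z).real A - a * surv Q T z) ∂ν) / N),
    b - κ * ((∫ z, (b * surv Q T z - (Q T z).real A) ∂ν) / N), ?_, fun x => ⟨?_, ?_⟩⟩
  · rw [integral_sub (hintA _) ((hQ.integrable_surv T _).const_mul a),
      integral_sub ((hQ.integrable_surv T _).const_mul b) (hintA _), integral_const_mul,
      integral_const_mul, ← hNdef]
    field_simp
    ring
  · have := hlow x
    rw [integral_sub (hintA (Q t₀ x)) ((hQ.integrable_surv T _).const_mul a), integral_const_mul,
      ← hQ.real_add t₀ T x hA, ← hQ.surv_add] at this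
    linarith
  · have := hup x
    rw [integral_sub ((hQ.integrable_surv T _).const_mul b) (hintA (Q t₀ x)), integral_const_mul,
      ← hQ.real_add t₀ T x hA, ← hQ.surv_add] at this
    linarith

theorem exists_bounds_nsmul_add {t₀ : ℝ≥0} {c₁ c₂ κ : ℝ} (hc₁ : 0 < c₁)
    (hκ : κ ≤ c₁ * c₂) (hκ1 : κ ≤ 1) {ν : Measure M} (hν : IsProbOn cem ν)
    (hmin : ∀ x A, MeasurableSet A → c₁ * surv Q t₀ x * ν.real A ≤ (Q t₀ x).real A)
    (hsurv : ∀ s z, c₂ * surv Q s z ≤ ∫ x, surv Q s x ∂ν) {A : Set M} (hA : MeasurableSet A)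
    (r : ℝ≥0) (n : ℕ) :
    ∃ a b, a ≤ b ∧ b - a = (1 - κ) ^ n ∧ ∀ x,
      a * surv Q (n * t₀ + r) x ≤ (Q (n * t₀ + r) x).real A ∧
        (Q (n * t₀ + r) x).real A ≤ b * surv Q (n * t₀ + r) x := by
  induction n with
  | zero =>
    refine ⟨0, 1, zero_le_one, by simp, fun x => ⟨by simp, ?_⟩⟩
    rw [one_mul]
    exact measureReal_mono (Set.subset_univ A)
  | succ n ih =>
    obtain ⟨a, b, hab, hba, h⟩ := ih
    obtain ⟨a', b', hba', h'⟩ := hQ.exists_bounds_add hc₁ hκ hν hmin hsurv hA h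
    have e : ((n + 1 : ℕ) : ℝ≥0) * t₀ + r = t₀ + (n * t₀ + r) := by push_cast; ring
    have e' : b' - a' = (1 - κ) ^ (n + 1) := by rw [hba', hba, pow_succ']
    rw [e]
    exact ⟨a', b', sub_nonneg.1 (e' ▸ pow_nonneg (sub_nonneg.2 hκ1) _), e', h'⟩

/-- Exponential contraction: `ℙ_x(X_t ∈ A | t < τ_∂)` varies exponentially little with `x`. -/
theorem exists_exponential_bounds {t₀ : ℝ≥0} (ht₀ : 0 < t₀) {c₁ c₂ : ℝ} (hc₁ : 0 < c₁)
    (hc₂ : 0 < c₂) {ν : Measure M} (hν : IsProbOn cem ν)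
    (hmin : ∀ x A, MeasurableSet A → c₁ * surv Q t₀ x * ν.real A ≤ (Q t₀ x).real A)
    (hsurv : ∀ s z, c₂ * surv Q s z ≤ ∫ x, surv Q s x ∂ν) :
    ∃ B γ : ℝ, 0 < B ∧ 0 < γ ∧ ∀ (t : ℝ≥0) (A : Set M), MeasurableSet A →
      ∃ a b, a ≤ b ∧ b - a ≤ B * Real.exp (-γ * t) ∧
        ∀ x, a * surv Q t x ≤ (Q t x).real A ∧ (Q t x).real A ≤ b * surv Q t x := by
  -- The cap at `1 / 2` keeps `1 - κ` positive, so its logarithm gives the rate. The prefactor `(1 -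
  -- κ)⁻¹` below pays for rounding `t / t₀` down to an integer.
  let κ : ℝ := min (c₁ * c₂) (1 / 2)
  have hκ0 : 0 < κ := lt_min (mul_pos hc₁ hc₂) (by norm_num)
  have hκ1 : κ ≤ 1 / 2 := min_le_right _ _
  have h1κ : 0 < 1 - κ := by linarith
  have hlog : Real.log (1 - κ) < 0 := Real.log_neg h1κ (by linarith)
  have ht₀' : (0 : ℝ) < t₀ := ht₀
  refine ⟨(1 - κ)⁻¹, -Real.log (1 - κ) / t₀, by positivity, div_pos (neg_pos.2 hlog) ht₀',
    fun t A hA => ?_⟩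
  let n : ℕ := ⌊(t / t₀ : ℝ)⌋₊
  have hn : (n : ℝ≥0) * t₀ ≤ t := by
    have : (n : ℝ) ≤ t / t₀ := Nat.floor_le (by positivity)
    rw [le_div_iff₀ ht₀'] at this
    exact_mod_cast this
  obtain ⟨r, hr⟩ := exists_add_of_le hn
  obtain ⟨a, b, hab, hba, h⟩ := hQ.exists_bounds_nsmul_add hc₁ (min_le_left _ _)
    (by linarith) hν hmin hsurv hA r n
  rw [← hr] at h
  refine ⟨a, b, hab, ?_, h⟩
  rw [hba, ← div_eq_inv_mul, le_div_iff₀ h1κ, ← pow_succ, ← Real.rpow_natCast,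
    Real.rpow_def_of_pos h1κ, Real.exp_le_exp]
  have hlt : (t / t₀ : ℝ) ≤ ((n + 1 : ℕ) : ℝ) := by
    push_cast; exact (Nat.lt_floor_add_one _).le
  have := mul_le_mul_of_nonpos_left hlt hlog.le
  calc Real.log (1 - κ) * ((n + 1 : ℕ) : ℝ) ≤ Real.log (1 - κ) * (t / t₀) := this
    _ = _ := by ring

theorem condEvol_real_mem_Icc {μ : Measure M} (hμ : IsProbOn cem μ) {t : ℝ≥0} {A : Set M}
    (hA : MeasurableSet A) {a b : ℝ}
    (h : ∀ x, a * surv Q t x ≤ (Q t x).real A ∧ (Q t x).real A ≤ b * surv Q t x) :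
    (condEvol Q t μ).real A ∈ Set.Icc a b := by
  have := hμ.1
  have hs := hQ.integrable_surv t μ
  have hi := integrable_of_abs_le μ (measurable_kernel_real (Q := Q) t hA)
    fun z => hQ.abs_real_le_one t z A
  rw [condEvol_real μ t hA, Set.mem_Icc, le_div_iff₀ (hQ.integral_surv_pos hμ t),
    div_le_iff₀ (hQ.integral_surv_pos hμ t), ← integral_const_mul, ← integral_const_mul]
  exact ⟨integral_mono (hs.const_mul a) hi fun x => (h x).1,
    integral_mono hi (hs.const_mul b) fun x => (h x).2⟩

end IsKilledSemigroup

end Evolution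

/-! ### Hitting times of closed sets by continuous paths -/

section HittingTimes

variable {M Ω : Type*} [MetricSpace M]

theorem hitTime_spec {X : ℝ≥0 → Ω → M} {ω : Ω} (hc : Continuous fun t => X t ω) {K : Set M}
    (hK : IsClosed K) (hT : hitTime X K ω ≠ ⊤) :
    ∃ s : ℝ≥0, hitTime X K ω = s ∧ X s ω ∈ K := by
  have hex : ∃ j : ℝ≥0, 0 ≤ j ∧ X j ω ∈ K := by
    by_contra! hcon
    exact hT (hittingAfter_eq_top_iff.2 hcon)
  refine ⟨sInf {i : ℝ≥0 | 0 ≤ i ∧ X i ω ∈ K}, ?_, ?_⟩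
  · rw [hitTime, hittingAfter, if_pos hex]
  · have hcl : IsClosed {i : ℝ≥0 | 0 ≤ i ∧ X i ω ∈ K} := by
      exact isClosed_Ici.inter (hK.preimage hc)
    exact (hcl.csInf_mem hex (OrderBot.bddBelow _)).2

theorem hitTime_le_iff {X : ℝ≥0 → Ω → M} {ω : Ω} (hc : Continuous fun t => X t ω) {K : Set M}
    (hK : IsClosed K) {t : ℝ≥0} : hitTime X K ω ≤ t ↔ ∃ s ≤ t, X s ω ∈ K := by
  constructor
  · intro h
    obtain ⟨s, hs, hsK⟩ := hitTime_spec hc hK (h.trans_lt (WithTop.coe_lt_top t)).ne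
    exact ⟨s, by rw [hs] at h; exact_mod_cast h, hsK⟩
  · rintro ⟨s, hst, hs⟩
    exact (hittingAfter_le_of_mem (zero_le) hs).trans (by exact_mod_cast hst)

theorem mem_alive_iff {X : ℝ≥0 → Ω → M} {cem : M} {ω : Ω} (hc : Continuous fun t => X t ω)
    {t : ℝ≥0} : ω ∈ alive X cem t ↔ ∀ s ≤ t, X s ω ≠ cem := by
  have := (hitTime_le_iff hc (isClosed_singleton (x := cem)) (t := t)).not
  push Not at this
  exact this

/-- A path on a compact time interval attains its minimal distance to `K`, and continuity lets a
dense set of times detect whether this minimum is 0. The event thus becomes a countable one, which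
makes the hitting time a stopping time for the natural filtration. -/
theorem exists_mem_iff_forall_thickening {w : ℝ≥0 → M} (hw : Continuous w) {K : Set M}
    (hK : IsClosed K) (t : ℝ≥0) :
    (∃ s ≤ t, w s ∈ K) ↔ ∀ n : ℕ, ∃ k : ℕ,
      w (TopologicalSpace.denseSeq (Set.Iic t) k) ∈ Metric.thickening (1 / (n + 1 : ℝ)) K := by
  constructor
  · rintro ⟨s, hst, hs⟩ n
    have ho : IsOpen {u : Set.Iic t | w u ∈ Metric.thickening (1 / (n + 1 : ℝ)) K} :=
      Metric.isOpen_thickening.preimage (hw.comp continuous_subtype_val)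
    exact (TopologicalSpace.denseRange_denseSeq (Set.Iic t)).exists_mem_open ho
      ⟨⟨s, hst⟩, Metric.self_subset_thickening (by positivity) K hs⟩
  · intro h
    have hcpt : IsCompact (Set.Iic t) := by
      rw [← Set.Icc_bot]; exact isCompact_Icc
    obtain ⟨s, hs, hmin⟩ := hcpt.exists_isMinOn ⟨t, Set.mem_Iic.2 le_rfl⟩
      (f := fun u => Metric.infEDist (w u) K)
      (Metric.continuous_infEDist.comp hw).continuousOn
    refine ⟨s, hs, ?_⟩
    rw [← hK.closure_eq, Metric.mem_closure_iff_infEDist_zero]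
    by_contra hne
    obtain ⟨n, hn⟩ := ENNReal.exists_inv_nat_lt hne
    obtain ⟨k, hk⟩ := h n
    have h1 : Metric.infEDist (w s) K ≤ _ :=
      hmin (TopologicalSpace.denseSeq (Set.Iic t) k).2
    have h2 := Metric.mem_thickening_iff_infEDist_lt.1 hk
    have h3 : ENNReal.ofReal (1 / (n + 1 : ℝ)) ≤ (n : ℝ≥0∞)⁻¹ := by
      rw [one_div, ENNReal.ofReal_inv_of_pos (by positivity)]
      refine ENNReal.inv_le_inv.2 ?_
      rw [← Nat.cast_succ, ENNReal.ofReal_natCast]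
      exact_mod_cast Nat.le_succ n
    exact absurd (h1.trans_lt (h2.trans_le h3)) hn.not_gt

variable [MeasurableSpace M] [BorelSpace M] [MeasurableSpace Ω]

theorem isStoppingTime_hitTime {X : ℝ≥0 → Ω → M} {F : Filtration ℝ≥0 ‹MeasurableSpace Ω›}
    (hF : ∀ s t, s ≤ t → Measurable[F t] (X s)) (hc : ∀ ω, Continuous fun t => X t ω) {K : Set M}
    (hK : IsClosed K) : IsStoppingTime F (hitTime X K) := by
  intro t
  have : {ω | hitTime X K ω ≤ t} = ⋂ n : ℕ, ⋃ k : ℕ,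
      X (TopologicalSpace.denseSeq (Set.Iic t) k) ⁻¹' Metric.thickening (1 / (n + 1 : ℝ)) K := by
    ext ω
    simpa using (hitTime_le_iff (hc ω) hK).trans (exists_mem_iff_forall_thickening (hc ω) hK t)
  rw [this]
  exact MeasurableSet.iInter fun n => MeasurableSet.iUnion fun k =>
    hF _ _ (TopologicalSpace.denseSeq (Set.Iic t) k).2 Metric.isOpen_thickening.measurableSet

end HittingTimes

/-! ### Survival events and the Markov property -/

namespace IsAbsorbedStrongMarkov

variable {M Ω : Type*} [MetricSpace M] [CompactSpace M] [MeasurableSpace M] [BorelSpace M]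
  [MeasurableSpace Ω] {cem : M} {X : ℝ≥0 → Ω → M} {P : Kernel M Ω}
  (hX : IsAbsorbedStrongMarkov cem X P)
include hX

theorem measurable_natural {s t : ℝ≥0} (hst : s ≤ t) :
    Measurable[Filtration.natural X (fun t => (hX.measurable t).stronglyMeasurable) t] (X s) :=
  Measurable.of_comap_le (le_iSup₂_of_le s hst le_rfl)

theorem isStoppingTime_hitTime {K : Set M} (hK : IsClosed K) :
    IsStoppingTime (Filtration.natural X fun t => (hX.measurable t).stronglyMeasurable)
      (hitTime X K) :=
  QSD.isStoppingTime_hitTime (fun _ _ => hX.measurable_natural) hX.continuous_paths hK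

theorem measurableSet_alive (t : ℝ≥0) : MeasurableSet (alive X cem t) := by
  have := ((hX.isStoppingTime_hitTime (isClosed_singleton (x := cem))).measurableSet_le t).compl
  have h2 : alive X cem t = {ω | hitTime X {cem} ω ≤ t}ᶜ := by
    ext ω; exact (not_le (a := hitTime X {cem} ω)).symm
  rw [h2]
  exact (Filtration.le _ t) _ this

theorem alive_ae_eq (x : M) (t : ℝ≥0) : alive X cem t =ᵐ[P x] X t ⁻¹' {cem}ᶜ := by
  refine Filter.eventuallyEq_set.2 ?_
  filter_upwards [hX.absorbed x] with ω hω
  rw [mem_alive_iff (hX.continuous_paths ω)]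
  exact ⟨fun h => h t le_rfl, fun h s hs e => h (hω s t hs e)⟩

/-- The Markov property at a deterministic time. -/
theorem markov (s : ℝ≥0) {D : Set (ℝ≥0 → M)} (hD : MeasurableSet D) (x : M) :
    P x {ω | (fun u => X (s + u) ω) ∈ D} =
      ∫⁻ ω, P (X s ω) {ω' | (fun u => X u ω') ∈ D} ∂(P x) := by
  have := hX.strong_markov (fun _ => (s : WithTop ℝ≥0)) (isStoppingTime_const _ s) Set.univ
    MeasurableSet.univ D hD x
  have htop : {ω : Ω | (s : WithTop ℝ≥0) ≠ ⊤} = Set.univ :=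
    Set.eq_univ_of_forall fun _ => WithTop.coe_ne_top
  rw [htop] at this
  simpa only [Set.univ_inter, Measure.restrict_univ, WithTop.untopD_coe] using this

end IsAbsorbedStrongMarkov

/-! ### The killed kernels of the process and their estimates -/

section KilledKernel

variable {M Ω : Type*} [MetricSpace M] [MeasurableSpace M] [BorelSpace M]
  [MeasurableSpace Ω]

/-- The transition kernels `Q_t(x, ·) = ℙ_x(X_t ∈ ·, X_t ≠ ∂)` of the killed process. -/
noncomputable def killedKernel (cem : M) (X : ℝ≥0 → Ω → M) (P : Kernel M Ω) (t : ℝ≥0) :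
    Kernel M M :=
  (P.map (X t)).restrict (measurableSet_singleton cem).compl

instance (cem : M) (X : ℝ≥0 → Ω → M) (P : Kernel M Ω) [IsMarkovKernel P] (t : ℝ≥0) :
    IsFiniteKernel (killedKernel cem X P t) := by
  unfold killedKernel; infer_instance

end KilledKernel

namespace IsAbsorbedStrongMarkov

variable {M Ω : Type*} [MetricSpace M] [CompactSpace M] [MeasurableSpace M] [BorelSpace M]
  [MeasurableSpace Ω] {cem : M} {X : ℝ≥0 → Ω → M} {P : Kernel M Ω}
  (hX : IsAbsorbedStrongMarkov cem X P)
include hX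

theorem killedKernel_apply' (t : ℝ≥0) (x : M) {A : Set M} (hA : MeasurableSet A) :
    killedKernel cem X P t x A = P x (X t ⁻¹' (A ∩ {cem}ᶜ)) := by
  rw [killedKernel, Kernel.restrict_apply' _ _ _ hA, Kernel.map_apply' _ (hX.measurable t) _
    (hA.inter (measurableSet_singleton cem).compl)]

theorem killedKernel_apply (t : ℝ≥0) (x : M) :
    killedKernel cem X P t x = ((P x).restrict (alive X cem t)).map (X t) := by
  rw [killedKernel, Kernel.restrict_apply, Kernel.map_apply _ (hX.measurable t),
    Measure.restrict_map (hX.measurable t) (measurableSet_singleton cem).compl,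
    Measure.restrict_congr_set (hX.alive_ae_eq x t)]

theorem killedKernel_univ (t : ℝ≥0) (x : M) :
    killedKernel cem X P t x Set.univ = P x (alive X cem t) := by
  rw [hX.killedKernel_apply, Measure.map_apply (hX.measurable t) MeasurableSet.univ]
  simp

theorem killedKernel_cem (t : ℝ≥0) : killedKernel cem X P t cem = 0 := by
  rw [← Measure.measure_univ_eq_zero, hX.killedKernel_apply' _ _ MeasurableSet.univ]
  have : ∀ᵐ ω ∂(P cem), X t ω = cem := by
    filter_upwards [hX.initial cem, hX.absorbed cem] with ω h0 h
    exact h 0 t (zero_le) h0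
  refine measure_mono_null ?_ this
  intro ω hω
  exact hω.2

theorem isKilledSemigroup [IsMarkovKernel P]
    (hpos : ∀ x, x ≠ cem → ∀ t : ℝ≥0, 0 < P x (alive X cem t)) :
    IsKilledSemigroup cem (killedKernel cem X P) where
  mass_le_one t x := by rw [hX.killedKernel_univ]; exact prob_le_one
  apply_cem t x := by
    rw [hX.killedKernel_apply' _ _ (measurableSet_singleton cem)]; simp
  at_cem := hX.killedKernel_cem
  pos t x hx := by rw [hX.killedKernel_univ]; exact hpos x hx t
  comp s t := by
    ext x A hA
    have hA' := hA.inter (measurableSet_singleton cem).compl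
    rw [Kernel.comp_apply' _ _ _ hA, hX.killedKernel_apply' _ _ hA]
    have h := hX.markov s (D := {w | w t ∈ A ∩ {cem}ᶜ}) (measurable_pi_apply t hA') x
    have h1 : ∀ z, P z {ω' | (fun u => X u ω') ∈ {w : ℝ≥0 → M | w t ∈ A ∩ {cem}ᶜ}} =
        killedKernel cem X P t z A := fun z => (hX.killedKernel_apply' t z hA).symm
    simp_rw [h1] at h
    refine h.trans ?_
    have hm := (killedKernel cem X P t).measurable_coe hA
    have hs : killedKernel cem X P s x = ((P x).map (X s)).restrict {cem}ᶜ := by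
      rw [killedKernel, Kernel.restrict_apply, Kernel.map_apply _ (hX.measurable s)]
    rw [hs, ← lintegral_map hm (hX.measurable s),
      ← lintegral_add_compl _ (measurableSet_singleton cem)]
    -- Paths already absorbed at time `s` contribute nothing, so the Markov property restricts to
    -- killed kernels.
    have h0 : ∫⁻ z in {cem}, killedKernel cem X P t z A ∂((P x).map (X s)) = 0 := by
      rw [setLIntegral_congr_fun (g := fun _ => 0) (measurableSet_singleton cem)]
      · simp
      · rintro z rfl
        simp [hX.killedKernel_cem]
    rw [h0, zero_add]

theorem dirichletSemigroup_eq (t : ℝ≥0) {f : M → ℝ} (hf : Measurable f) (x : M) :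
    dirichletSemigroup cem X P t f x = ∫ y, f y ∂(killedKernel cem X P t x) := by
  rw [hX.killedKernel_apply, integral_map (hX.measurable t).aemeasurable
    hf.aestronglyMeasurable, dirichletSemigroup]

theorem map_restrict_alive_comp (μ : Measure M) (t : ℝ≥0) :
    ((P ∘ₘ μ).restrict (alive X cem t)).map (X t) = killedKernel cem X P t ∘ₘ μ := by
  ext A hA
  have hal := hX.measurableSet_alive t
  have hpre := hX.measurable t hA
  rw [Measure.map_apply (hX.measurable t) hA, Measure.restrict_apply hpre,
    Measure.bind_apply (hpre.inter hal) P.aemeasurable,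
    Measure.bind_apply hA (killedKernel cem X P t).aemeasurable]
  refine lintegral_congr fun x => ?_
  rw [hX.killedKernel_apply, Measure.map_apply (hX.measurable t) hA, Measure.restrict_apply hpre]

theorem comp_alive (μ : Measure M) (t : ℝ≥0) :
    (P ∘ₘ μ) (alive X cem t) = (killedKernel cem X P t ∘ₘ μ) Set.univ := by
  rw [← hX.map_restrict_alive_comp, Measure.map_apply (hX.measurable t) MeasurableSet.univ]
  simp

theorem condLaw_comp (μ : Measure M) (t : ℝ≥0) :
    condLaw cem X (P ∘ₘ μ) t = condEvol (killedKernel cem X P) t μ := by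
  rw [condEvol, condLaw, ProbabilityTheory.cond, Measure.map_smul,
    hX.map_restrict_alive_comp, hX.comp_alive]

theorem condLaw_apply (x : M) (t : ℝ≥0) :
    condLaw cem X (P x) t = (killedKernel cem X P t x Set.univ)⁻¹ • killedKernel cem X P t x := by
  rw [condLaw, ProbabilityTheory.cond, Measure.map_smul, hX.killedKernel_univ,
    hX.killedKernel_apply]

theorem tvLipschitz {t₁ : ℝ≥0} {C : ℝ≥0}
    (h : ∀ f : M → ℝ, Measurable f → (∃ b : ℝ, ∀ x, |f x| ≤ b) →
      gradNorm (dirichletSemigroup cem X P t₁ f) ≤ C * supNorm f) :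
    TVLipschitz (killedKernel cem X P) t₁ C := by
  intro f hf b hb x y
  have hb0 : 0 ≤ b := (abs_nonneg _).trans (hb x)
  rw [← hX.dirichletSemigroup_eq t₁ hf, ← hX.dirichletSemigroup_eq t₁ hf]
  rcases eq_or_ne x y with rfl | hxy
  · simp
  have h1 := h f hf ⟨b, hb⟩
  set g := dirichletSemigroup cem X P t₁ f
  have h2 : ‖g x - g y‖ₑ / edist x y ≤ gradNorm g :=
    le_iSup₂ (f := fun x y => ‖g x - g y‖ₑ / edist x y) x y
  have h3 : supNorm f ≤ ENNReal.ofReal b := iSup_le fun z => by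
    rw [← ofReal_norm]; exact ENNReal.ofReal_le_ofReal (hb z)
  have h4 : ‖g x - g y‖ₑ / edist x y ≤ C * ENNReal.ofReal b :=
    h2.trans (h1.trans (by gcongr))
  rw [ENNReal.div_le_iff (edist_pos.2 hxy).ne' (edist_ne_top _ _), edist_dist,
    ← ofReal_norm, ← ENNReal.ofReal_coe_nnreal, ← ENNReal.ofReal_mul C.coe_nonneg,
    ← ENNReal.ofReal_mul (by positivity)] at h4
  exact (ENNReal.ofReal_le_ofReal_iff (by positivity)).1 h4

theorem real_closedBall_pos [IsMarkovKernel P] {t₁ : ℝ≥0}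
    (hirr : ∀ x y, x ≠ cem → y ≠ cem → ∀ r : ℝ, 0 < r →
      0 < P x {ω | ∀ s ∈ Set.Icc t₁ (2 * t₁), X s ω ∈ Metric.ball y r})
    {x y : M} (hx : x ≠ cem) (hy : y ≠ cem) {r : ℝ} (hr : 0 < r) :
    0 < (killedKernel cem X P t₁ x).real (Metric.closedBall y r) := by
  refine ENNReal.toReal_pos ?_ (measure_ne_top _ _)
  rw [hX.killedKernel_apply' _ _ Metric.isClosed_closedBall.measurableSet]
  have hd : 0 < dist y cem := dist_pos.2 hy
  -- Shrinking the radius to at most `dist y cem` keeps `cem` out of the open ball.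
  refine ((hirr x y hx hy (min r (dist y cem)) (lt_min hr hd)).trans_le
    (measure_mono fun ω hω => ?_)).ne'
  have h1 : dist (X t₁ ω) y < min r (dist y cem) :=
    hω t₁ ⟨le_rfl, le_mul_of_one_le_left zero_le one_le_two⟩
  refine ⟨(h1.trans_le (min_le_left _ _)).le, fun e => ?_⟩
  have e' : X t₁ ω = cem := e
  rw [e', dist_comm] at h1
  exact absurd (h1.trans_le (min_le_right _ _)) (lt_irrefl _)

/-- From a compact subset of `E`, the process stays in a given ball over `[t₁, 2 t₁]` with
probability bounded below. The event is expressed through a countable dense set of times. -/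
theorem exists_le_stay [IsMarkovKernel P] {t₁ : ℝ≥0} {C : ℝ}
    (hL : TVLipschitz (killedKernel cem X P) t₁ C) (hC : 0 ≤ C)
    (hirr : ∀ x y, x ≠ cem → y ≠ cem → ∀ r : ℝ, 0 < r →
      0 < P x {ω | ∀ s ∈ Set.Icc t₁ (2 * t₁), X s ω ∈ Metric.ball y r})
    {K : Set M} (hK : IsCompact K) (hKc : cem ∉ K) {y : M} (hy : y ≠ cem) {r : ℝ} (hr : 0 < r)
    (hyr : cem ∉ Metric.closedBall y r) {S : Set ℝ≥0} (hS : S.Countable) (h0 : 0 ∈ S)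
    (hSt : ∀ s ∈ S, s ≤ t₁) :
    ∃ c, 0 < c ∧ ∀ x ∈ K,
      c ≤ (P x).real {ω | ∀ s ∈ S, X (t₁ + s) ω ∈ Metric.closedBall y r} := by
  let D : Set (ℝ≥0 → M) := {w | ∀ s ∈ S, w s ∈ Metric.closedBall y r}
  have hD : MeasurableSet D := by
    have : D = ⋂ s ∈ S, (fun w : ℝ≥0 → M => w s) ⁻¹' Metric.closedBall y r := by
      ext w; simp [D]
    rw [this]
    exact MeasurableSet.biInter hS fun s _ =>
      measurable_pi_apply s Metric.isClosed_closedBall.measurableSet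
  have hXm : Measurable fun ω (u : ℝ≥0) => X u ω := measurable_pi_lambda _ hX.measurable
  let g : M → ℝ := fun z => (P z).real {ω | (fun u => X u ω) ∈ D}
  have hgm : Measurable g := (P.measurable_coe (hXm hD)).ennreal_toReal
  have hgb : ∀ z, |g z| ≤ 1 := fun z => by
    rw [abs_of_nonneg measureReal_nonneg]; exact measureReal_le_one
  have hgc : g cem = 0 := by
    refine (measureReal_eq_zero_iff (measure_ne_top _ _)).2
      (measure_mono_null (fun ω hω => ?_) (hX.initial cem))
    intro e
    exact hyr (e ▸ hω 0 h0)
  -- By the Markov property the probability is `Q t₁` applied to the bounded function `g`, hence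
  -- continuous in `x`. Killing costs nothing because `g cem = 0`, which is where `0 ∈ S` is used.
  have key : ∀ x, (P x).real {ω | ∀ s ∈ S, X (t₁ + s) ω ∈ Metric.closedBall y r} =
      ∫ z, g z ∂(killedKernel cem X P t₁ x) := fun x => by
    have h := hX.markov t₁ hD x
    have e1 : (P x).real {ω | ∀ s ∈ S, X (t₁ + s) ω ∈ Metric.closedBall y r} =
        ∫ ω, g (X t₁ ω) ∂(P x) := by
      refine Eq.trans ?_ (integral_toReal
        (((P.measurable_coe (hXm hD)).comp (hX.measurable t₁)).aemeasurable)
        (Filter.Eventually.of_forall fun _ => measure_lt_top _ _)).symm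
      exact congrArg ENNReal.toReal h
    rw [e1, ← hX.dirichletSemigroup_eq t₁ hgm, dirichletSemigroup,
      setIntegral_congr_set (hX.alive_ae_eq x t₁)]
    refine (setIntegral_eq_integral_of_forall_compl_eq_zero fun ω hω => ?_).symm
    have : X t₁ ω = cem := by simpa using hω
    rw [this, hgc]
  refine exists_pos_forall_le_of_isCompact hK ?_ fun x hx => ?_
  · simp_rw [key]
    exact (hL.continuous hC hgm hgb).continuousOn
  · refine ENNReal.toReal_pos ?_ (measure_ne_top _ _)
    refine ((hirr x y (fun e => hKc (e ▸ hx)) hy r hr).trans_le (measure_mono fun ω hω => ?_)).ne'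
    intro s hs
    exact Metric.ball_subset_closedBall
      (hω (t₁ + s) ⟨le_self_add, by rw [two_mul]; gcongr; exact hSt s hs⟩)

/-- Uniform return to a compact subset of `E` by time `2 t₁`. -/
theorem exists_return [IsMarkovKernel P] {t₁ : ℝ≥0} {C : ℝ}
    (hL : TVLipschitz (killedKernel cem X P) t₁ C) (hC : 0 ≤ C) (hE : ∃ x : M, x ≠ cem)
    (hret : ∃ K : Set M, IsCompact K ∧ cem ∉ K ∧ ∃ C' : ℝ, 0 < C' ∧ ∀ x, x ≠ cem →
      C' * dist x cem ≤
        (P x).real {ω | hitTime X K ω ≤ (t₁ : WithTop ℝ≥0) ∧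
          (t₁ : WithTop ℝ≥0) < hitTime X {cem} ω})
    (hirr : ∀ x y, x ≠ cem → y ≠ cem → ∀ r : ℝ, 0 < r →
      0 < P x {ω | ∀ s ∈ Set.Icc t₁ (2 * t₁), X s ω ∈ Metric.ball y r}) :
    ∃ K : Set M, IsCompact K ∧ cem ∉ K ∧ ∃ c : ℝ, 0 < c ∧ ∀ x,
      c * dist x cem ≤ (killedKernel cem X P (t₁ + t₁) x).real K := by
  obtain ⟨K, hK, hKc, C', hC', hret⟩ := hret
  obtain ⟨y, hy⟩ := hE
  have hd : 0 < dist y cem := dist_pos.2 hy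
  have hyr : cem ∉ Metric.closedBall y (dist y cem / 2) := by
    rw [Metric.mem_closedBall, dist_comm]; linarith
  -- Countably many times make the path event measurable in the product σ-algebra; density recovers
  -- the whole interval by path continuity.
  let S : Set ℝ≥0 := insert 0 (Set.range fun n => (TopologicalSpace.denseSeq (Set.Iic t₁) n : ℝ≥0))
  have hS : S.Countable := (Set.countable_range _).insert 0
  have hSt : ∀ s ∈ S, s ≤ t₁ := by
    rintro s (rfl | ⟨n, rfl⟩)
    · exact zero_le
    · exact (TopologicalSpace.denseSeq (Set.Iic t₁) n).2
  obtain ⟨c, hc, Hc⟩ := hX.exists_le_stay hL hC hirr hK hKc hy (half_pos hd) hyr hS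
    (Set.mem_insert _ _) hSt
  refine ⟨Metric.closedBall y (dist y cem / 2), Metric.isClosed_closedBall.isCompact, hyr,
    c * C', by positivity, fun x => ?_⟩
  rcases eq_or_ne x cem with rfl | hx
  · simp
  have hT := hX.isStoppingTime_hitTime hK.isClosed
  let A : Set Ω := {ω | hitTime X K ω ≤ t₁}
  have hA : MeasurableSet[hT.measurableSpace] A := hT.measurableSet_le' t₁
  have hAm : MeasurableSet A := hT.measurableSpace_le _ hA
  have hAtop : A ∩ {ω | hitTime X K ω ≠ ⊤} = A := by
    refine Set.inter_eq_left.2 fun ω hω => ?_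
    have : hitTime X K ω ≤ t₁ := hω
    exact (this.trans_lt (WithTop.coe_lt_top t₁)).ne
  let D : Set (ℝ≥0 → M) := {w | ∀ s ∈ S, w (t₁ + s) ∈ Metric.closedBall y (dist y cem / 2)}
  have hD : MeasurableSet D := by
    have : D = ⋂ s ∈ S, (fun w : ℝ≥0 → M => w (t₁ + s)) ⁻¹'
        Metric.closedBall y (dist y cem / 2) := by
      ext w; simp [D]
    rw [this]
    exact MeasurableSet.biInter hS fun s _ =>
      measurable_pi_apply (t₁ + s) Metric.isClosed_closedBall.measurableSet
  have hSM := hX.strong_markov _ hT A hA D hD x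
  rw [hAtop] at hSM
  have hlow : ENNReal.ofReal c * P x A ≤ P x (A ∩ {ω | (fun s =>
      X ((hitTime X K ω).untopD 0 + s) ω) ∈ D}) := by
    rw [hSM, ← setLIntegral_const]
    refine setLIntegral_mono' hAm fun ω hω => ?_
    have hω' : hitTime X K ω ≤ t₁ := hω
    obtain ⟨s, hs, hsK⟩ := hitTime_spec (hX.continuous_paths ω) hK.isClosed
      (hω'.trans_lt (WithTop.coe_lt_top t₁)).ne
    rw [hs, WithTop.untopD_coe]
    exact (ENNReal.ofReal_le_iff_le_toReal (measure_ne_top _ _)).2 (Hc _ hsK)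
  -- If `K` is hit at `s ≤ t₁` and the ball is then occupied throughout `[s + t₁, s + 2 t₁]`, it is
  -- occupied at the deterministic time `2 t₁`, which lies in that interval.
  have hup : P x (A ∩ {ω | (fun s => X ((hitTime X K ω).untopD 0 + s) ω) ∈ D}) ≤
      killedKernel cem X P (t₁ + t₁) x (Metric.closedBall y (dist y cem / 2)) := by
    rw [hX.killedKernel_apply' _ _ Metric.isClosed_closedBall.measurableSet]
    refine measure_mono fun ω hω => ?_
    obtain ⟨hωA, hωD⟩ := hω
    have hω' : hitTime X K ω ≤ t₁ := hωA
    obtain ⟨s, hs, hsK⟩ := hitTime_spec (hX.continuous_paths ω) hK.isClosed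
      (hω'.trans_lt (WithTop.coe_lt_top t₁)).ne
    have hst : s ≤ t₁ := by rw [hs] at hω'; exact_mod_cast hω'
    have hωD' : ∀ u ∈ S, X (s + (t₁ + u)) ω ∈ Metric.closedBall y (dist y cem / 2) := by
      have : ∀ u ∈ S, X ((hitTime X K ω).untopD 0 + (t₁ + u)) ω ∈
        Metric.closedBall y (dist y cem / 2) := hωD
      rwa [hs] at this
    have hall : ∀ u : Set.Iic t₁,
        X (s + (t₁ + u)) ω ∈ Metric.closedBall y (dist y cem / 2) := by
      have hcl : IsClosed {u : Set.Iic t₁ |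
          X (s + (t₁ + u)) ω ∈ Metric.closedBall y (dist y cem / 2)} := by
        refine Metric.isClosed_closedBall.preimage ?_
        exact (hX.continuous_paths ω).comp (by fun_prop)
      intro u
      refine hcl.closure_subset_iff.2 ?_ (TopologicalSpace.denseRange_denseSeq (Set.Iic t₁) u)
      rintro _ ⟨n, rfl⟩
      exact hωD' _ (Set.mem_insert_of_mem _ ⟨n, rfl⟩)
    have hfin := hall ⟨t₁ - s, Set.mem_Iic.2 tsub_le_self⟩
    have e : s + (t₁ + (t₁ - s)) = t₁ + t₁ := by
      rw [add_left_comm, add_tsub_cancel_of_le hst]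
    simp only [e] at hfin
    exact ⟨hfin, fun e' => hyr (e' ▸ hfin)⟩
  have h1 : c * (P x).real A ≤
      (killedKernel cem X P (t₁ + t₁) x).real (Metric.closedBall y (dist y cem / 2)) := by
    have := ENNReal.toReal_mono (measure_ne_top _ _) (hlow.trans hup)
    rwa [ENNReal.toReal_mul, ENNReal.toReal_ofReal hc.le] at this
  calc c * C' * dist x cem = c * (C' * dist x cem) := by ring
    _ ≤ c * (P x).real A := by
      gcongr
      exact (hret x hx).trans (measureReal_mono fun ω hω => hω.1)
    _ ≤ _ := h1

end IsAbsorbedStrongMarkov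

/-! ### Dependence on the initial law and existence of a fixed point -/

namespace IsKilledSemigroup

variable {M : Type*} [MeasurableSpace M] [MeasurableSingletonClass M] {cem : M}
  {Q : ℝ≥0 → Kernel M M} [∀ t, IsFiniteKernel (Q t)]

section

variable (hQ : IsKilledSemigroup cem Q)
include hQ

theorem abs_condEvol_sub_le {μ₁ μ₂ : Measure M} (h₁ : IsProbOn cem μ₁) (h₂ : IsProbOn cem μ₂)
    {t : ℝ≥0} {A : Set M} (hA : MeasurableSet A) {a b : ℝ}
    (h : ∀ x, a * surv Q t x ≤ (Q t x).real A ∧ (Q t x).real A ≤ b * surv Q t x) :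
    |(condEvol Q t μ₁).real A - (condEvol Q t μ₂).real A| ≤ b - a := by
  have k₁ := hQ.condEvol_real_mem_Icc h₁ hA h
  have k₂ := hQ.condEvol_real_mem_Icc h₂ hA h
  rw [abs_le]
  constructor <;> linarith [k₁.1, k₁.2, k₂.1, k₂.2]

/-- The conditional laws depend on the initial distribution in a Lipschitz way. -/
theorem abs_condEvol_sub_le_mul_tvDist {μ₁ μ₂ : Measure M} [IsProbabilityMeasure μ₁]
    [IsProbabilityMeasure μ₂] (h₁ : μ₁ {cem} = 0) (h₂ : μ₂ {cem} = 0) {t : ℝ≥0} {A : Set M}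
    (hA : MeasurableSet A) {a b : ℝ} (hab : a ≤ b)
    (h : ∀ x, a * surv Q t x ≤ (Q t x).real A ∧ (Q t x).real A ≤ b * surv Q t x) {d : ℝ}
    (hd : 0 < d) (hsurv : ∀ z, d * surv Q t z ≤ ∫ x, surv Q t x ∂μ₁) :
    |(condEvol Q t μ₁).real A - (condEvol Q t μ₂).real A| ≤
      2 * (b - a) / d * tvDist μ₁ μ₂ := by
  have hN₁ := hQ.integral_surv_pos ⟨inferInstance, h₁⟩ t
  have hN₂ := hQ.integral_surv_pos ⟨inferInstance, h₂⟩ t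
  have hmem := hQ.condEvol_real_mem_Icc ⟨inferInstance, h₂⟩ hA h
  rw [condEvol_real μ₂ t hA] at hmem
  rw [condEvol_real μ₁ t hA, condEvol_real μ₂ t hA]
  set N₁ := ∫ x, surv Q t x ∂μ₁
  set N₂ := ∫ x, surv Q t x ∂μ₂
  have hsup : ∀ z, surv Q t z ≤ N₁ / d := fun z => by
    rw [le_div_iff₀ hd, mul_comm]; exact hsurv z
  have hi : ∀ (m : Measure M) [IsFiniteMeasure m], Integrable (fun z => (Q t z).real A) m :=
    fun m _ => integrable_of_abs_le m (measurable_kernel_real t hA)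
      fun z => hQ.abs_real_le_one t z A
  have hg := abs_integral_sub_le_mul_tvDist (μ := μ₁) (ν := μ₂)
    (f := fun z => (Q t z).real A - a * surv Q t z) (b := (b - a) * (N₁ / d))
    ((measurable_kernel_real t hA).sub ((measurable_surv t).const_mul a)) fun z => by
      rw [abs_of_nonneg (sub_nonneg.2 (h z).1)]
      calc (Q t z).real A - a * surv Q t z ≤ (b - a) * surv Q t z := by linarith [(h z).2]
        _ ≤ (b - a) * (N₁ / d) := mul_le_mul_of_nonneg_left (hsup z) (sub_nonneg.2 hab)
  have hh := abs_integral_sub_le_mul_tvDist (μ := μ₁) (ν := μ₂) (measurable_surv (Q := Q) t)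
    (b := N₁ / d) fun z => by rw [abs_of_nonneg (surv_nonneg _ _)]; exact hsup z
  rw [integral_sub (hi _) ((hQ.integrable_surv t _).const_mul a),
    integral_sub (hi _) ((hQ.integrable_surv t _).const_mul a), integral_const_mul,
    integral_const_mul] at hg
  set I₁ := ∫ x, (Q t x).real A ∂μ₁
  set I₂ := ∫ x, (Q t x).real A ∂μ₂
  -- Centring at `a` puts a factor `b - a` in both terms: in the first through the integrand, in the
  -- second through `I₂ / N₂ - a`.
  have e : I₁ / N₁ - I₂ / N₂ =
      ((I₁ - a * N₁ - (I₂ - a * N₂)) + (I₂ / N₂ - a) * (N₂ - N₁)) / N₁ := by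
    field_simp
    ring
  have hθ : |I₂ / N₂ - a| ≤ b - a := by
    rw [abs_of_nonneg (sub_nonneg.2 hmem.1)]; linarith [hmem.2]
  rw [e, abs_div, abs_of_pos hN₁, div_le_iff₀ hN₁]
  calc |I₁ - a * N₁ - (I₂ - a * N₂) + (I₂ / N₂ - a) * (N₂ - N₁)|
      ≤ |I₁ - a * N₁ - (I₂ - a * N₂)| + |(I₂ / N₂ - a) * (N₂ - N₁)| := abs_add_le _ _
    _ ≤ (b - a) * (N₁ / d) * tvDist μ₁ μ₂ + (b - a) * (N₁ / d * tvDist μ₁ μ₂) := by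
      rw [abs_mul, abs_sub_comm N₂]
      gcongr
    _ = 2 * (b - a) / d * tvDist μ₁ μ₂ * N₁ := by ring

/-- Existence of a quasi-stationary distribution. -/
theorem exists_condEvol_eq (hE : ∃ x : M, x ≠ cem) {B γ : ℝ} (hγ : 0 < γ)
    (hexp : ∀ (t : ℝ≥0) (A : Set M), MeasurableSet A →
      ∃ a b, a ≤ b ∧ b - a ≤ B * Real.exp (-γ * t) ∧
        ∀ x, a * surv Q t x ≤ (Q t x).real A ∧ (Q t x).real A ≤ b * surv Q t x) :
    ∃ α : Measure M, IsProbOn cem α ∧ ∀ t, condEvol Q t α = α := by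
  obtain ⟨e, he⟩ := hE
  let δ : Measure M := Measure.dirac e
  have hδ : IsProbOn cem δ := ⟨inferInstance, by
    rw [Measure.dirac_apply' _ (measurableSet_singleton cem)]; simp [he]⟩
  let ε : ℕ → ℝ := fun n => B * Real.exp (-γ * (n : ℝ≥0))
  have hε : Filter.Tendsto ε Filter.atTop (nhds 0) := by
    have h1 : Filter.Tendsto (fun n : ℕ => -γ * ((n : ℝ≥0) : ℝ)) Filter.atTop Filter.atBot := by
      simp only [NNReal.coe_natCast]
      exact tendsto_natCast_atTop_atTop.const_mul_atTop_of_neg (by linarith)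
    simpa [ε] using (Real.tendsto_exp_atBot.comp h1).const_mul B
  let Φ : ℕ → Measure M := fun n => condEvol Q n δ
  have hΦ : ∀ n, IsProbOn cem (Φ n) := fun n => hQ.isProbOn_condEvol hδ n
  have hΦp : ∀ n, IsProbabilityMeasure (Φ n) := fun n => (hΦ n).1
  -- Running for `t + n` is running for `n` from the conditional law at `t`, and all laws agree up
  -- to `ε n` after time `n`.
  have hshift : ∀ (n : ℕ) (t : ℝ≥0) A, MeasurableSet A →
      |(condEvol Q (t + n) δ).real A - (Φ n).real A| ≤ ε n := fun n t A hA => by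
    obtain ⟨a, b, -, hab, h⟩ := hexp n A hA
    rw [← hQ.condEvol_condEvol_real hδ t n hA]
    exact (hQ.abs_condEvol_sub_le (hQ.isProbOn_condEvol hδ t) hδ hA h).trans hab
  obtain ⟨α, hα, hlim⟩ := exists_isProbabilityMeasure_of_cauchy (μ := Φ) hε fun n k A hA => by
    have := hshift n k A hA
    rwa [add_comm, ← Nat.cast_add] at this
  have hconst : ∀ {u : ℕ → ℝ} {l : ℝ}, (∀ n, |u n - l| ≤ ε n) →
      Filter.Tendsto u Filter.atTop (nhds l) := fun {u l} h =>
    tendsto_iff_dist_tendsto_zero.2 (squeeze_zero (fun _ => dist_nonneg) h hε)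
  have hαc : α {cem} = 0 := by
    have h1 := hconst fun n => hlim n {cem} (measurableSet_singleton cem)
    have h2 : ∀ n, (Φ n).real {cem} = 0 := fun n => by rw [measureReal_def, (hΦ n).2]; rfl
    simp only [h2] at h1
    exact (measureReal_eq_zero_iff (measure_ne_top _ _)).1
      (tendsto_nhds_unique h1 tendsto_const_nhds)
  have hαE : IsProbOn cem α := ⟨hα, hαc⟩
  refine ⟨α, hαE, fun t => ?_⟩
  have := (hQ.isProbOn_condEvol hαE t).1
  refine Measure.ext fun A hA => ?_
  rw [← measureReal_eq_measureReal_iff]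
  -- Uniform setwise closeness is closeness in total variation, so integrals of bounded functions
  -- converge.
  have hint : ∀ A, MeasurableSet A → Filter.Tendsto (fun n => ∫ x, (Q t x).real A ∂(Φ n))
      Filter.atTop (nhds (∫ x, (Q t x).real A ∂α)) := fun A hA => by
    refine tendsto_iff_dist_tendsto_zero.2 (squeeze_zero (g := fun n => 2 * ε n)
      (fun _ => dist_nonneg) (fun n => ?_) (by simpa using hε.const_mul 2))
    have h1 := abs_integral_sub_le_mul_tvDist (μ := Φ n) (ν := α)
      (measurable_kernel_real (Q := Q) t hA) fun z => hQ.abs_real_le_one t z A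
    rw [one_mul] at h1
    exact h1.trans (tvDist_le_two_mul fun A hA => hlim n A hA)
  have hquot : Filter.Tendsto (fun n => (condEvol Q t (Φ n)).real A) Filter.atTop
      (nhds ((condEvol Q t α).real A)) := by
    simp only [condEvol_real _ t hA]
    exact (hint A hA).div (hint _ MeasurableSet.univ) (hQ.integral_surv_pos hαE t).ne'
  refine tendsto_nhds_unique hquot ?_
  have h1 := hconst fun n => hlim n A hA
  have h2 : Filter.Tendsto (fun n => (condEvol Q t (Φ n)).real A - (Φ n).real A) Filter.atTop
      (nhds 0) := by
    refine hconst fun n => ?_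
    rw [sub_zero, hQ.condEvol_condEvol_real hδ n t hA, add_comm]
    exact hshift n t A hA
  simpa using h2.add h1

end

end IsKilledSemigroup

/-! ### Condition (A) for the process -/

namespace IsAbsorbedStrongMarkov

variable {M Ω : Type*} [MetricSpace M] [CompactSpace M] [MeasurableSpace M] [BorelSpace M]
  [MeasurableSpace Ω] {cem : M} {X : ℝ≥0 → Ω → M} {P : Kernel M Ω} [IsMarkovKernel P]
  (hX : IsAbsorbedStrongMarkov cem X P)
include hX

theorem conditionA (hQ : IsKilledSemigroup cem (killedKernel cem X P)) {t₀ : ℝ≥0} (ht₀ : 0 < t₀)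
    {c₁ c₂ : ℝ} (hc₁ : 0 < c₁) (hc₂ : 0 < c₂) {ν : Measure M} (hν : IsProbOn cem ν)
    (hmin : ∀ x A, MeasurableSet A → c₁ * surv (killedKernel cem X P) t₀ x * ν.real A ≤
      (killedKernel cem X P t₀ x).real A)
    (hsurv : ∀ s z, c₂ * surv (killedKernel cem X P) s z ≤
      ∫ x, surv (killedKernel cem X P) s x ∂ν) : ConditionA cem X P := by
  have := hν.1
  refine ⟨t₀, c₁.toNNReal, c₂.toNNReal, ht₀, by simpa, by simpa, ν, hν, fun x hx => ?_,
    fun z _ t => ?_⟩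
  · refine Measure.le_iff.2 fun A hA => ?_
    have hpos : 0 < (killedKernel cem X P t₀ x Set.univ).toReal := hQ.surv_pos t₀ hx
    rw [Measure.smul_apply, ENNReal.smul_def, smul_eq_mul,
      ← ENNReal.toReal_le_toReal (by finiteness) (measure_ne_top _ _),
      hX.condLaw_apply, Measure.smul_apply, smul_eq_mul, ENNReal.toReal_mul, ENNReal.toReal_mul,
      ENNReal.toReal_inv, ENNReal.coe_toReal,
      Real.coe_toNNReal _ hc₁.le, ← div_eq_inv_mul, le_div_iff₀ hpos]
    have := hmin x A hA
    calc c₁ * (ν A).toReal * _ = c₁ * surv (killedKernel cem X P) t₀ x * ν.real A := by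
          rw [surv, measureReal_def, measureReal_def]; ring
      _ ≤ _ := this
  · rw [hX.comp_alive, ← hX.killedKernel_univ,
      ← ENNReal.toReal_le_toReal (by finiteness) (measure_ne_top _ _), ENNReal.toReal_mul,
      ENNReal.coe_toReal, Real.coe_toNNReal _ hc₂.le]
    refine (hsurv t z).trans_eq ?_
    exact (comp_real_apply ν t MeasurableSet.univ).symm

end IsAbsorbedStrongMarkov

end QSD

/-! ### Assembly of the three conclusions -/

theorem mainTheorem2 {M Ω : Type*} [MetricSpace M] [CompactSpace M] [MeasurableSpace M]
    [BorelSpace M] [MeasurableSpace Ω]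
    (cem : M) (hE : ∃ x : M, x ≠ cem)
    (X : ℝ≥0 → Ω → M) (P : Kernel M Ω) [IsMarkovKernel P]
    (hX : QSD.IsAbsorbedStrongMarkov cem X P)
    (hpos : ∀ x, x ≠ cem → ∀ t : ℝ≥0, 0 < P x (QSD.alive X cem t))
    (t₁ : ℝ≥0) (ht₁ : 0 < t₁)
    (hgrad : ∃ C : ℝ≥0, ∀ f : M → ℝ, Measurable f → (∃ b : ℝ, ∀ x, |f x| ≤ b) →
      QSD.gradNorm (QSD.dirichletSemigroup cem X P t₁ f) ≤ C * QSD.supNorm f)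
    (hret : ∃ K : Set M, IsCompact K ∧ cem ∉ K ∧ ∃ C' : ℝ, 0 < C' ∧ ∀ x, x ≠ cem →
      C' * dist x cem ≤
        (P x).real {ω | QSD.hitTime X K ω ≤ (t₁ : WithTop ℝ≥0) ∧
          (t₁ : WithTop ℝ≥0) < QSD.hitTime X {cem} ω})
    (hirr : ∀ x y, x ≠ cem → y ≠ cem → ∀ r : ℝ, 0 < r →
      0 < P x {ω | ∀ s ∈ Set.Icc t₁ (2 * t₁), X s ω ∈ Metric.ball y r}) :
    QSD.ConditionA cem X P ∧
    (∃ (α : Measure M) (_ : IsProbabilityMeasure α),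
      QSD.IsQSD cem X P α ∧ (∀ β : Measure M, QSD.IsQSD cem X P β → β = α) ∧
      ∃ B γ : ℝ, 0 < B ∧ 0 < γ ∧
        ∀ μ : Measure M, QSD.IsProbOn cem μ → ∀ t : ℝ≥0,
          QSD.tvDist (QSD.condLaw cem X (P ∘ₘ μ) t) α ≤ B * Real.exp (-γ * t)) ∧
    (∃ B γ : ℝ, 0 < B ∧ 0 < γ ∧
      ∀ (μ₁ μ₂ : Measure M) [IsProbabilityMeasure μ₁] [IsProbabilityMeasure μ₂],
        μ₁ {cem} = 0 → μ₂ {cem} = 0 → ∀ t : ℝ≥0,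
          QSD.tvDist (QSD.condLaw cem X (P ∘ₘ μ₁) t) (QSD.condLaw cem X (P ∘ₘ μ₂) t) ≤
            B * Real.exp (-γ * t) / max (∫ x, dist x cem ∂μ₁) (∫ x, dist x cem ∂μ₂) *
              QSD.tvDist μ₁ μ₂) := by
  set Q := QSD.killedKernel cem X P with hQdef
  have hQ : QSD.IsKilledSemigroup cem Q := hX.isKilledSemigroup hpos
  obtain ⟨C, hC⟩ := hgrad
  -- Replacing `C` by `C + 1` makes the constant positive, since it is later divided by.
  have hL : QSD.TVLipschitz Q t₁ (C + 1 : ℝ≥0) :=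
    hX.tvLipschitz fun f hf hb => (hC f hf hb).trans (by gcongr; exact le_self_add)
  have hC1 : (0 : ℝ) < (C + 1 : ℝ≥0) := by positivity
  have hR : ∀ x y, x ≠ cem → y ≠ cem → ∀ r : ℝ, 0 < r →
      0 < (Q t₁ x).real (Metric.closedBall y r) :=
    fun x y hx hy r hr => hX.real_closedBall_pos hirr hx hy hr
  obtain ⟨K, hK, hKc, c₀, hc₀, hret'⟩ := hX.exists_return hL hC1.le hE hret hirr
  obtain ⟨c, hc, hdist⟩ := hL.exists_mul_dist_mul_surv_le hC1 hQ hE hR hK hKc hc₀ hret'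
  obtain ⟨t₀, ht₀, c₁, hc₁, ν, hν, hmin⟩ :=
    hL.exists_conditional_minorization hC1 ht₁ hQ hE hR hK hKc hc₀ hret'
  obtain ⟨R, hRb⟩ : ∃ R, ∀ x : M, |dist x cem| ≤ R := by
    obtain ⟨R, hR⟩ :=
      (Metric.isBounded_of_compactSpace (s := (Set.univ : Set M))).subset_closedBall cem
    exact ⟨R, fun x => by rw [abs_of_nonneg dist_nonneg]; exact hR (Set.mem_univ x)⟩
  have hdm : Measurable fun x : M => dist x cem := by fun_prop
  have hdint : ∀ μ : Measure M, IsFiniteMeasure μ → Integrable (fun x => dist x cem) μ :=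
    fun μ _ => QSD.integrable_of_abs_le μ hdm hRb
  have hdpos : ∀ μ : Measure M, QSD.IsProbOn cem μ → 0 < ∫ x, dist x cem ∂μ := fun μ hμ => by
    have := hμ.1
    rw [integral_pos_iff_support_of_nonneg (fun _ => dist_nonneg) (hdint μ inferInstance)]
    have h1 : μ {cem}ᶜ = 1 := (prob_compl_eq_one_iff (measurableSet_singleton cem)).2 hμ.2
    refine lt_of_lt_of_le (by rw [h1]; exact one_pos) (measure_mono (s := {cem}ᶜ) fun x hx => ?_)
    exact (dist_pos.2 hx).ne'
  have hsurv : ∀ μ : Measure M, IsProbabilityMeasure μ → ∀ s z,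
      c * (∫ x, dist x cem ∂μ) * QSD.surv Q s z ≤ ∫ x, QSD.surv Q s x ∂μ := fun μ _ s z => by
    rw [← integral_const_mul, ← integral_mul_const]
    exact integral_mono (((hdint μ inferInstance).const_mul c).mul_const _)
      (hQ.integrable_surv s μ) fun x => hdist s x z
  have := hν.1
  have hc₂ : 0 < c * ∫ x, dist x cem ∂ν := mul_pos hc (hdpos ν hν)
  obtain ⟨B, γ, hB, hγ, hexp⟩ :=
    hQ.exists_exponential_bounds ht₀ hc₁ hc₂ hν hmin (hsurv ν inferInstance)
  refine ⟨hX.conditionA hQ ht₀ hc₁ hc₂ hν hmin (hsurv ν inferInstance), ?_, ?_⟩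
  · obtain ⟨α, hα, hαfix⟩ := hQ.exists_condEvol_eq hE hγ hexp
    have := hα.1
    have hclose : ∀ μ, QSD.IsProbOn cem μ → ∀ (t : ℝ≥0) A, MeasurableSet A →
        |(QSD.condLaw cem X (P ∘ₘ μ) t).real A - α.real A| ≤ B * Real.exp (-γ * t) :=
      fun μ hμ t A hA => by
        obtain ⟨a, b, -, hab, h⟩ := hexp t A hA
        have := hQ.abs_condEvol_sub_le hμ hα hA h
        rw [hαfix t] at this
        rw [hX.condLaw_comp]
        exact this.trans hab
    refine ⟨α, hα.1, ⟨hα, fun t => ?_⟩, fun β hβ => ?_, 2 * B, γ, by positivity, hγ,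
      fun μ hμ t => ?_⟩
    · rw [hX.condLaw_comp]; exact hαfix t
    -- A quasi-stationary `β` is its own conditional law at every time, so its distance to `α` is
    -- below a bound tending to 0.
    · have := hβ.1.1
      refine Measure.ext fun A hA => ?_
      rw [← measureReal_eq_measureReal_iff, ← sub_eq_zero, ← abs_eq_zero]
      refine le_antisymm (ge_of_tendsto' (x := Filter.atTop)
        (f := fun n : ℕ => B * Real.exp (-γ * (n : ℝ≥0))) ?_ fun n => ?_) (abs_nonneg _)
      · have h1 : Filter.Tendsto (fun n : ℕ => -γ * ((n : ℝ≥0) : ℝ)) Filter.atTop Filter.atBot := by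
          simp only [NNReal.coe_natCast]
          exact tendsto_natCast_atTop_atTop.const_mul_atTop_of_neg (by linarith)
        simpa using (Real.tendsto_exp_atBot.comp h1).const_mul B
      · have := hclose β hβ.1 n A hA
        rwa [hβ.2] at this
    · rw [mul_assoc]
      exact QSD.tvDist_le_two_mul fun A hA => hclose μ hμ t A hA
  -- One factor 2 comes from numerator and normalisation both varying, the other from passing from
  -- sets to total variation. The maximum is reached by applying `key` with the two laws in either
  -- order.
  · refine ⟨4 * B / c, γ, by positivity, hγ, fun μ₁ μ₂ _ _ h₁ h₂ t => ?_⟩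
    have key : ∀ (μ₁ μ₂ : Measure M) [IsProbabilityMeasure μ₁] [IsProbabilityMeasure μ₂],
        μ₁ {cem} = 0 → μ₂ {cem} = 0 →
        QSD.tvDist (QSD.condLaw cem X (P ∘ₘ μ₁) t) (QSD.condLaw cem X (P ∘ₘ μ₂) t) ≤
          4 * B / c * Real.exp (-γ * t) / (∫ x, dist x cem ∂μ₁) * QSD.tvDist μ₁ μ₂ := by
      intro μ₁ μ₂ _ _ h₁ h₂
      have hd := hdpos μ₁ ⟨inferInstance, h₁⟩
      have htv := QSD.tvDist_nonneg μ₁ μ₂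
      calc QSD.tvDist (QSD.condLaw cem X (P ∘ₘ μ₁) t) (QSD.condLaw cem X (P ∘ₘ μ₂) t)
          ≤ 2 * (2 * (B * Real.exp (-γ * t)) / (c * ∫ x, dist x cem ∂μ₁) *
              QSD.tvDist μ₁ μ₂) := by
            refine QSD.tvDist_le_two_mul fun A hA => ?_
            obtain ⟨a, b, hle, hab, h⟩ := hexp t A hA
            rw [hX.condLaw_comp, hX.condLaw_comp]
            refine (hQ.abs_condEvol_sub_le_mul_tvDist h₁ h₂ hA hle h (mul_pos hc hd)
              (hsurv μ₁ inferInstance t)).trans ?_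
            gcongr
        _ = _ := by field_simp; ring
    rcases max_choice (∫ x, dist x cem ∂μ₁) (∫ x, dist x cem ∂μ₂) with h | h
    · rw [h]; exact key μ₁ μ₂ h₁ h₂
    · rw [h, QSD.tvDist_comm, QSD.tvDist_comm μ₁]; exact key μ₂ μ₁ h₂ h₁
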